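/- Let $d$ be a natural number and let $A\in GL_d(\mathbb{Q})$ have no complex eigenvalue of modulus $1$. Let $\mathbb{Z}\ltimes_A\mathbb{Q}^d$ be the semidirect product in which the generator $1\in\mathbb{Z}$ acts on $\mathbb{Q}^d$ by $v\mapsto Av$, and let $G=\mathbb{Z}\ltimes_A H=\{(n,h): n\in\mathbb{Z},\ h\in H\}$ be a subgroup of it, where $H$ is a subgroup of $\mathbb{Q}^d$ of $\mathbb{Q}$-rank $d$ (that is, $H$ spans $\mathbb{Q}^d$ over $\mathbb{Q}$). Let $\mathrm{Diff}^1_+([0,1])$ be the group of orientation-preserving $C^1$ diffeomorphisms of $[0,1]$, and let $\mathrm{Aff}_+(\mathbb{R})$ be the group of maps $x\mapsto \lambda x+t$ of $\mathbb{R}$ with $\lambda>0$ and $t\in\mathbb{R}$. Then for every homomorphism $\rho:G\to \mathrm{Diff}^1_+([0,1])$ such that no point of $(0,1)$ is fixed by all of $\rho(G)$, there are a homomorphism $\psi: G\to\mathrm{Aff}_+(\mathbb{R})$ and a homeomorphism $\varphi:(0,1)\to\mathbb{R}$ such that $\varphi(\rho(g)(x))=\psi(g)(\varphi(x))$ for all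 $g\in G$ and all $x\in(0,1)$. -/

import Mathlib

open scoped unitInterval MatrixGroups

noncomputable section

namespace AffRigidity

/-! ### The group `ℤ ⋉_A ℚ^d` -/

/-- The automorphism `v ↦ A v` of the additive group `ℚ^d`, written multiplicatively. -/
def matAut {d : ℕ} (A : GL (Fin d) ℚ) : MulAut (Multiplicative (Fin d → ℚ)) :=
  AddEquiv.toMultiplicative
    { toFun := fun v => (A : Matrix (Fin d) (Fin d) ℚ).mulVec v
      invFun := fun v => ((A⁻¹ : GL (Fin d) ℚ) : Matrix (Fin d) (Fin d) ℚ).mulVec v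
      left_inv := fun v => by
        beta_reduce
        rw [Matrix.mulVec_mulVec, ← Units.val_mul, inv_mul_cancel, Units.val_one,
          Matrix.one_mulVec]
      right_inv := fun v => by
        beta_reduce
        rw [Matrix.mulVec_mulVec, ← Units.val_mul, mul_inv_cancel, Units.val_one,
          Matrix.one_mulVec]
      map_add' := fun v w => Matrix.mulVec_add _ v w }

/-- The semidirect product `ℤ ⋉_A ℚ^d`, in which `n ∈ ℤ` acts on `ℚ^d` by `A ^ n`. -/
abbrev MatSemidirect {d : ℕ} (A : GL (Fin d) ℚ) : Type :=
  Multiplicative (Fin d → ℚ) ⋊[zpowersHom _ (matAut A)] Multiplicative ℤ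

/-! ### Orientation-preserving `C¹` diffeomorphisms of `[0,1]` -/

/-- A self-map of `[0,1]`, seen as a function on `ℝ` that only matters on `[0,1]`, is `C¹`
on `[0,1]` (one-sided derivatives at the endpoints). -/
def IsC1 (f : I → I) : Prop :=
  ContDiffOn ℝ 1 (fun x : ℝ => (f (Set.projIcc (0 : ℝ) 1 zero_le_one x) : ℝ)) (Set.Icc 0 1)

theorem IsC1.comp {f g : I → I} (hf : IsC1 f) (hg : IsC1 g) : IsC1 (f ∘ g) := by
  have h := ContDiffOn.comp (s := Set.Icc (0 : ℝ) 1) hf hg (fun x _ => (g _).2)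
  refine h.congr fun x _ => ?_
  simp [Function.comp, Set.projIcc_val]

theorem isC1_id : IsC1 id := by
  refine (contDiffOn_id (s := Set.Icc (0 : ℝ) 1)).congr fun x hx => ?_
  simp [Set.projIcc_of_mem zero_le_one hx]

/-- The group `Diff¹₊([0,1])`: increasing homeomorphisms `f` of `[0,1]` such that both `f` and
`f⁻¹` are of class `C¹`. -/
def Diff1Plus : Subgroup (I ≃ₜ I) where
  carrier := {f | StrictMono f ∧ IsC1 f ∧ IsC1 f.symm}
  mul_mem' := fun {f g} hf hg =>
    ⟨hf.1.comp hg.1, hf.2.1.comp hg.2.1, hg.2.2.comp hf.2.2⟩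
  one_mem' := ⟨strictMono_id, isC1_id, isC1_id⟩
  inv_mem' := fun {f} hf =>
    ⟨fun x y h => hf.1.lt_iff_lt.1
      (by simpa using (show f (f.symm x) < f (f.symm y) by simpa using h)),
      hf.2.2, hf.2.1⟩

theorem diff1Plus_mem_Ioo (f : Diff1Plus) (x : Set.Ioo (0 : ℝ) 1) :
    ((f : I ≃ₜ I) ⟨x, Set.Ioo_subset_Icc_self x.2⟩ : ℝ) ∈ Set.Ioo (0 : ℝ) 1 := by
  have h := f.2.1
  constructor
  · have h0 : (⟨0, by simp⟩ : I) < ⟨x, Set.Ioo_subset_Icc_self x.2⟩ := x.2.1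
    exact lt_of_le_of_lt ((f : I ≃ₜ I) _).2.1 (h h0)
  · have h1 : (⟨x, Set.Ioo_subset_Icc_self x.2⟩ : I) < ⟨1, by simp⟩ := x.2.2
    exact lt_of_lt_of_le (h h1) ((f : I ≃ₜ I) _).2.2

/-- The restriction of `f ∈ Diff¹₊([0,1])` to the open interval `(0,1)`. -/
def onIoo (f : Diff1Plus) (x : Set.Ioo (0 : ℝ) 1) : Set.Ioo (0 : ℝ) 1 :=
  ⟨(f : I ≃ₜ I) ⟨x, Set.Ioo_subset_Icc_self x.2⟩, diff1Plus_mem_Ioo f x⟩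

/-! ### The affine group of the line -/

/-- The group `Aff₊(ℝ)` of the maps `x ↦ λ x + t` with `λ > 0`. -/
def AffPlus : Subgroup (ℝ ≃ᵃ[ℝ] ℝ) where
  carrier := {f | 0 < f.linear 1}
  mul_mem' := fun {f g} (hf : 0 < f.linear 1) (hg : 0 < g.linear 1) => by
    change 0 < f.linear (g.linear 1)
    have : f.linear (g.linear 1) = g.linear 1 * f.linear 1 := by
      rw [← smul_eq_mul, ← map_smul, smul_eq_mul, mul_one]
    rw [this]
    exact mul_pos hg hf
  one_mem' := by
    change (0 : ℝ) < 1
    exact one_pos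
  inv_mem' := fun {f} (hf : 0 < f.linear 1) => by
    change 0 < f.linear.symm 1
    have : f.linear.symm 1 * f.linear 1 = 1 := by
      rw [← smul_eq_mul, ← map_smul, smul_eq_mul, mul_one, LinearEquiv.apply_symm_apply]
    refine pos_of_mul_pos_left ?_ hf.le
    rw [this]
    exact one_pos

/-! ### Topological conjugacy -/

/-- The action `ρ` of `G` on `(0,1)` is topologically conjugate to the action `ψ` of `G` on `ℝ` by
affine maps: some homeomorphism `φ : (0,1) → ℝ` satisfies `φ ∘ ρ(g) = ψ(g) ∘ φ` for all `g`. -/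
def TopConjugate {G : Type*} [Group G] (ρ : G →* Diff1Plus) (ψ : G →* AffPlus) : Prop :=
  ∃ φ : Set.Ioo (0 : ℝ) 1 ≃ₜ ℝ, ∀ (g : G) (x : Set.Ioo (0 : ℝ) 1),
    φ (onIoo (ρ g) x) = (ψ g : ℝ ≃ᵃ[ℝ] ℝ) (φ x)

end AffRigidity

end

namespace AffRigidity

section LinearAlgebra

theorem exists_nsmul_mem_of_span_eq_top {V : Type*} [AddCommGroup V] [Module ℚ V]
    {H : AddSubgroup V} (hH : Submodule.span ℚ (H : Set V) = ⊤) (v : V) :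
    ∃ N : ℕ, 0 < N ∧ N • v ∈ H := by
  have hv : v ∈ Submodule.span ℚ (H : Set V) := hH ▸ Submodule.mem_top
  induction hv using Submodule.span_induction with
  | mem x hx => exact ⟨1, one_pos, by simpa using hx⟩
  | zero => exact ⟨1, one_pos, by simp⟩
  | add x y _ _ hx hy =>
    obtain ⟨N, hN, h1⟩ := hx
    obtain ⟨K, hK, h2⟩ := hy
    refine ⟨N * K, Nat.mul_pos hN hK, ?_⟩
    rw [smul_add, mul_smul, mul_smul, smul_comm N K x]
    exact H.add_mem (H.nsmul_mem h1 K) (H.nsmul_mem h2 N)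
  | smul c x _ hx =>
    obtain ⟨N, hN, h1⟩ := hx
    refine ⟨c.den * N, Nat.mul_pos c.den_pos hN, ?_⟩
    have : (c.den * N) • c • x = c.num • N • x := by
      rw [← Nat.cast_smul_eq_nsmul ℚ (c.den * N), ← Nat.cast_smul_eq_nsmul ℚ N,
        ← Int.cast_smul_eq_zsmul ℚ c.num, smul_smul, smul_smul]
      congr 1
      push_cast
      rw [mul_right_comm, Rat.den_mul_eq_num]
    rw [this]
    exact H.zsmul_mem h1 _

theorem exists_linearMap_extension {V E : Type*} [AddCommGroup V] [Module ℚ V]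
    [AddCommGroup E] [Module ℚ E] {H : AddSubgroup V}
    (hH : ∀ v : V, ∃ N : ℕ, 0 < N ∧ N • v ∈ H) (θ : H →+ E) :
    ∃ Θ : V →ₗ[ℚ] E, ∀ h : H, Θ h = θ h := by
  choose N hN hNH using hH
  have key : ∀ (v : V) (k : ℕ) (hk : 0 < k) (hkv : k • v ∈ H),
      (k : ℚ)⁻¹ • θ ⟨k • v, hkv⟩ = (N v : ℚ)⁻¹ • θ ⟨N v • v, hNH v⟩ := by
    intro v k hk hkv
    have h1 : N v • θ ⟨k • v, hkv⟩ = k • θ ⟨N v • v, hNH v⟩ := by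
      rw [← map_nsmul, ← map_nsmul]
      congr 1
      ext1
      exact smul_comm _ _ _
    have hk' : (k : ℚ) ≠ 0 := by exact_mod_cast hk.ne'
    have hN' : (N v : ℚ) ≠ 0 := by exact_mod_cast (hN v).ne'
    rw [inv_smul_eq_iff₀ hk', smul_comm, eq_inv_smul_iff₀ hN', Nat.cast_smul_eq_nsmul,
      Nat.cast_smul_eq_nsmul]
    exact h1
  let Θ : V →+ E := AddMonoidHom.mk' (fun v => (N v : ℚ)⁻¹ • θ ⟨N v • v, hNH v⟩) (by
    intro v w
    have hv : (N v * N w) • v ∈ H := by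
      rw [mul_comm, mul_smul]; exact H.nsmul_mem (hNH v) _
    have hw : (N v * N w) • w ∈ H := by
      rw [mul_smul]; exact H.nsmul_mem (hNH w) _
    have hvw : (N v * N w) • (v + w) ∈ H := by rw [smul_add]; exact H.add_mem hv hw
    have hpos := Nat.mul_pos (hN v) (hN w)
    rw [← key v _ hpos hv, ← key w _ hpos hw, ← key (v + w) _ hpos hvw, ← smul_add, ← map_add]
    congr 2
    ext1
    exact smul_add _ _ _)
  refine ⟨Θ.toRatLinearMap, fun h => ?_⟩
  have h1 : (1 : ℕ) • (h : V) ∈ H := by simp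
  change (N (h : V) : ℚ)⁻¹ • θ _ = _
  rw [← key h 1 one_pos h1]
  simp

/-- The functionals `Θ` whose values along every orbit of `T` and of `T⁻¹` grow subexponentially. -/
def subexpSubmodule {V : Type*} [AddCommGroup V] [Module ℚ V] (T : V ≃ₗ[ℚ] V) :
    Submodule ℂ (V →ₗ[ℚ] ℂ) where
  carrier := {Θ | ∀ v, ∀ r : ℝ, 1 < r → ∃ C : ℝ, ∀ n : ℕ,
    ‖Θ (T^[n] v)‖ ≤ C * r ^ n ∧ ‖Θ (T.symm^[n] v)‖ ≤ C * r ^ n}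
  zero_mem' := fun v r hr => ⟨0, by simp⟩
  add_mem' := by
    intro Θ Θ' h h' v r hr
    obtain ⟨C, hC⟩ := h v r hr
    obtain ⟨C', hC'⟩ := h' v r hr
    refine ⟨C + C', fun n => ⟨?_, ?_⟩⟩
    · rw [LinearMap.add_apply, add_mul]
      exact (norm_add_le _ _).trans (add_le_add (hC n).1 (hC' n).1)
    · rw [LinearMap.add_apply, add_mul]
      exact (norm_add_le _ _).trans (add_le_add (hC n).2 (hC' n).2)
  smul_mem' := by
    intro c Θ h v r hr
    obtain ⟨C, hC⟩ := h v r hr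
    refine ⟨‖c‖ * C, fun n => ⟨?_, ?_⟩⟩
    · rw [LinearMap.smul_apply, norm_smul, mul_assoc]
      exact mul_le_mul_of_nonneg_left (hC n).1 (norm_nonneg _)
    · rw [LinearMap.smul_apply, norm_smul, mul_assoc]
      exact mul_le_mul_of_nonneg_left (hC n).2 (norm_nonneg _)

theorem norm_le_one_of_pow_le {x B : ℝ} (hB : 0 < B)
    (h : ∀ r : ℝ, 1 < r → ∃ C : ℝ, ∀ n : ℕ, x ^ n * B ≤ C * r ^ n) : x ≤ 1 := by
  by_contra! hx1
  obtain ⟨r, hr1, hrx⟩ := exists_between hx1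
  obtain ⟨C, hC⟩ := h r hr1
  have hr0 : 0 < r := one_pos.trans hr1
  obtain ⟨n, hn⟩ := pow_unbounded_of_one_lt (C / B) ((one_lt_div hr0).2 hrx)
  rw [div_pow, div_lt_div_iff₀ hB (pow_pos hr0 n)] at hn
  exact absurd (hC n) (not_le.2 hn)

theorem eq_zero_of_mem_subexpSubmodule {V : Type*} [AddCommGroup V] [Module ℚ V]
    [Module.Finite ℂ (V →ₗ[ℚ] ℂ)] (T : V ≃ₗ[ℚ] V)
    (hT : ∀ (z : ℂ) (Θ : V →ₗ[ℚ] ℂ), Θ ≠ 0 → (∀ v, Θ (T v) = z * Θ v) → ‖z‖ ≠ 1)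
    {Θ : V →ₗ[ℚ] ℂ} (hΘ : Θ ∈ subexpSubmodule T) : Θ = 0 := by
  by_contra hne
  let F : Module.End ℂ (V →ₗ[ℚ] ℂ) :=
    { toFun := fun Θ => Θ.comp (T : V →ₗ[ℚ] V)
      map_add' := fun _ _ => rfl
      map_smul' := fun _ _ => rfl }
  have hF : ∀ Θ ∈ subexpSubmodule T, F Θ ∈ subexpSubmodule T := by
    intro Θ h v r hr
    obtain ⟨C, hC⟩ := h (T v) r hr
    refine ⟨C, fun n => ⟨?_, ?_⟩⟩
    · have : F Θ (T^[n] v) = Θ (T^[n] (T v)) := by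
        change Θ (T (T^[n] v)) = _
        rw [← Function.iterate_succ_apply' (⇑T), Function.iterate_succ_apply]
      rw [this]
      exact (hC n).1
    · have : F Θ (T.symm^[n] v) = Θ (T.symm^[n] (T v)) := by
        change Θ (T (T.symm^[n] v)) = _
        have hc : Function.Commute (T : V → V) (T.symm : V → V) := fun x => by simp
        rw [(hc.iterate_right n).eq v]
      rw [this]
      exact (hC n).2
  let W := subexpSubmodule T
  have : Nontrivial W := ⟨⟨⟨Θ, hΘ⟩, 0, fun h => hne (congrArg Subtype.val h)⟩⟩
  obtain ⟨z, hz⟩ := Module.End.exists_eigenvalue (F.restrict hF : Module.End ℂ W)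
  obtain ⟨⟨Ψ, hΨ⟩, hev⟩ := hz.exists_hasEigenvector
  have hΨ0 : Ψ ≠ 0 := fun h => hev.2 (Subtype.ext h)
  have hz1 : ∀ v, Ψ (T v) = z * Ψ v := fun v =>
    LinearMap.congr_fun (congrArg Subtype.val hev.apply_eq_smul) v
  obtain ⟨v, hv⟩ : ∃ v, Ψ v ≠ 0 := by
    by_contra! h
    exact hΨ0 (LinearMap.ext h)
  have hz0 : z ≠ 0 := by
    rintro rfl
    have := hz1 (T.symm v)
    simp at this
    exact hv this
  have hz2 : ∀ v, Ψ (T.symm v) = z⁻¹ * Ψ v := fun v => by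
    have := hz1 (T.symm v)
    rw [LinearEquiv.apply_symm_apply] at this
    rw [this, inv_mul_cancel_left₀ hz0]
  have hn1 : ∀ n : ℕ, Ψ (T^[n] v) = z ^ n * Ψ v := by
    intro n
    induction n with
    | zero => simp
    | succ n ih => rw [Function.iterate_succ_apply', hz1, ih, pow_succ']; ring
  have hn2 : ∀ n : ℕ, Ψ (T.symm^[n] v) = z⁻¹ ^ n * Ψ v := by
    intro n
    induction n with
    | zero => simp
    | succ n ih => rw [Function.iterate_succ_apply', hz2, ih, pow_succ']; ring
  have hle1 : ‖z‖ ≤ 1 := by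
    refine norm_le_one_of_pow_le (norm_pos_iff.2 hv) fun r hr => ?_
    obtain ⟨C, hC⟩ := hΨ v r hr
    refine ⟨C, fun n => ?_⟩
    rw [← norm_pow, ← norm_mul, ← hn1]
    exact (hC n).1
  have hle2 : ‖z⁻¹‖ ≤ 1 := by
    refine norm_le_one_of_pow_le (norm_pos_iff.2 hv) fun r hr => ?_
    obtain ⟨C, hC⟩ := hΨ v r hr
    refine ⟨C, fun n => ?_⟩
    rw [← norm_pow, ← norm_mul, ← hn2]
    exact (hC n).2
  refine hT z Ψ hΨ0 hz1 (le_antisymm hle1 ?_)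
  rw [norm_inv] at hle2
  exact (inv_le_one_iff₀.1 hle2).resolve_left (not_le.2 (norm_pos_iff.2 hz0))

/-- An additive functional on a group with an automorphism which has subexponential growth along
the orbits of the automorphism and of its inverse. -/
def IsSubexp {M : Type*} [AddCommGroup M] (α : M ≃+ M) (τ : M →+ ℝ) : Prop :=
  ∀ m, ∀ r : ℝ, 1 < r → ∃ C : ℝ, ∀ n : ℕ,
    |τ (α^[n] m)| ≤ C * r ^ n ∧ |τ (α.symm^[n] m)| ≤ C * r ^ n

theorem isSubexp_of_map_eq {M : Type*} [AddCommGroup M] {α : M ≃+ M} {τ : M →+ ℝ}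
    (h : ∀ m, τ (α m) = τ m) : IsSubexp α τ := by
  have h' : ∀ m, τ (α.symm m) = τ m := fun m => by rw [← h, AddEquiv.apply_symm_apply]
  refine fun m r hr => ⟨|τ m|, fun n => ?_⟩
  have h1 : ∀ n : ℕ, τ (α^[n] m) = τ m := fun n => by
    induction n with
    | zero => rfl
    | succ n ih => rw [Function.iterate_succ_apply', h, ih]
  have h2 : ∀ n : ℕ, τ (α.symm^[n] m) = τ m := fun n => by
    induction n with
    | zero => rfl
    | succ n ih => rw [Function.iterate_succ_apply', h', ih]
  rw [h1, h2]
  have := le_mul_of_one_le_right (abs_nonneg (τ m)) (one_le_pow₀ (n := n) hr.le)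
  exact ⟨this, this⟩

theorem eq_zero_of_isSubexp {V : Type*} [AddCommGroup V] [Module ℚ V]
    [Module.Finite ℂ (V →ₗ[ℚ] ℂ)] (T : V ≃ₗ[ℚ] V)
    (hT : ∀ (z : ℂ) (Θ : V →ₗ[ℚ] ℂ), Θ ≠ 0 → (∀ v, Θ (T v) = z * Θ v) → ‖z‖ ≠ 1)
    {H : AddSubgroup V} (hH : ∀ v : V, ∃ N : ℕ, 0 < N ∧ N • v ∈ H)
    (α : H ≃+ H) (hα : ∀ h : H, (α h : V) = T h) {τ : H →+ ℝ} (hτ : IsSubexp α τ) : τ = 0 := by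
  obtain ⟨Θ, hΘ⟩ := exists_linearMap_extension hH
    (Complex.ofRealHom.toAddMonoidHom.comp τ)
  have hΘ' : ∀ h : H, Θ h = (τ h : ℂ) := hΘ
  have hα' : ∀ h : H, (α.symm h : V) = T.symm h := fun h => by
    rw [LinearEquiv.eq_symm_apply, ← hα, AddEquiv.apply_symm_apply]
  have hn : ∀ (n : ℕ) (h : H), ((α^[n] h : H) : V) = T^[n] h := by
    intro n h
    induction n with
    | zero => rfl
    | succ n ih => rw [Function.iterate_succ_apply', Function.iterate_succ_apply', hα, ih]
  have hn' : ∀ (n : ℕ) (h : H), ((α.symm^[n] h : H) : V) = T.symm^[n] h := by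
    intro n h
    induction n with
    | zero => rfl
    | succ n ih => rw [Function.iterate_succ_apply', Function.iterate_succ_apply', hα', ih]
  have hTn : ∀ (n N : ℕ) (v : V), T^[n] (N • v) = N • T^[n] v := by
    intro n N v
    induction n with
    | zero => rfl
    | succ n ih => rw [Function.iterate_succ_apply', Function.iterate_succ_apply', ih, map_nsmul]
  have hTn' : ∀ (n N : ℕ) (v : V), T.symm^[n] (N • v) = N • T.symm^[n] v := by
    intro n N v
    induction n with
    | zero => rfl
    | succ n ih => rw [Function.iterate_succ_apply', Function.iterate_succ_apply', ih, map_nsmul]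
  have h0 : Θ = 0 := by
    refine eq_zero_of_mem_subexpSubmodule T hT fun v r hr => ?_
    obtain ⟨N, hN, hv⟩ := hH v
    obtain ⟨C, hC⟩ := hτ ⟨N • v, hv⟩ r hr
    have hN1 : (1 : ℝ) ≤ N := by exact_mod_cast hN
    have hle : ∀ w : V, ‖Θ w‖ ≤ ‖Θ (N • w)‖ := fun w => by
      rw [map_nsmul, nsmul_eq_mul, norm_mul, Complex.norm_natCast]
      exact le_mul_of_one_le_left (norm_nonneg _) hN1
    refine ⟨C, fun n => ⟨?_, ?_⟩⟩
    · refine (hle _).trans ?_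
      have := (hC n).1
      rw [← hTn, show N • v = ((⟨N • v, hv⟩ : H) : V) from rfl, ← hn, hΘ', Complex.norm_real]
      exact this
    · refine (hle _).trans ?_
      have := (hC n).2
      rw [← hTn', show N • v = ((⟨N • v, hv⟩ : H) : V) from rfl, ← hn', hΘ', Complex.norm_real]
      exact this
  ext h
  have := hΘ' h
  rw [h0] at this
  simpa using this.symm

theorem hasEigenvalue_of_functional {d : ℕ} (A : Matrix (Fin d) (Fin d) ℚ) {z : ℂ}
    {Θ : (Fin d → ℚ) →ₗ[ℚ] ℂ} (h0 : Θ ≠ 0) (h : ∀ v, Θ (A.mulVec v) = z * Θ v) :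
    Module.End.HasEigenvalue (Matrix.toLin' (A.map (algebraMap ℚ ℂ))) z := by
  set B := A.map (algebraMap ℚ ℂ) with hB
  let u : Fin d → ℂ := fun i => Θ (Pi.single i 1)
  have hu0 : u ≠ 0 := by
    intro hu
    apply h0
    refine LinearMap.pi_ext' fun i => LinearMap.ext_ring ?_
    simpa using congrFun hu i
  have hu : Matrix.vecMul u B = z • u := by
    ext j
    have := h (Pi.single j 1)
    rw [Matrix.mulVec_single_one, LinearMap.pi_apply_eq_sum_univ] at this
    simp only [Matrix.vecMul, dotProduct, Pi.smul_apply, smul_eq_mul]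
    rw [← this]
    refine Finset.sum_congr rfl fun i _ => ?_
    have hs : (Pi.single i (1 : ℚ) : Fin d → ℚ) = fun j => if i = j then 1 else 0 := by
      ext k; simp [Pi.single_apply, eq_comm]
    simp only [u, hB, Matrix.map_apply, Matrix.col_apply, hs]
    rw [Algebra.smul_def, mul_comm]
  rw [Module.End.hasEigenvalue_iff_isRoot_charpoly, Matrix.charpoly_toLin',
    ← Matrix.charpoly_transpose, ← Matrix.charpoly_toLin',
    ← Module.End.hasEigenvalue_iff_isRoot_charpoly]
  refine Module.End.hasEigenvalue_of_hasEigenvector (x := u) ⟨?_, hu0⟩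
  rw [Module.End.mem_eigenspace_iff, Matrix.toLin'_apply, Matrix.mulVec_transpose]
  exact hu

end LinearAlgebra

section Order

theorem common_fixed_point {F : Set I} (hF : ∀ Z ⊆ F, sSup Z ∈ F ∧ sInf Z ∈ F) {s : I ≃o I}
    (hs : ∀ z, s z ∈ F ↔ z ∈ F) {p q x y : I} (hx : x ∈ Set.Ioo p q) (hxF : x ∈ F)
    (hy : y ∈ Set.Ioo p q) (hys : s y = y) : ∃ z ∈ Set.Ioo p q, z ∈ F ∧ s z = z := by
  have hys' : s.symm y = y := by rw [OrderIso.symm_apply_eq, hys]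
  have hs' : ∀ z, s.symm z ∈ F ↔ z ∈ F := fun z => by rw [← hs, OrderIso.apply_symm_apply]
  rcases le_total x y with hxy | hxy
  · set Z := {z | z ∈ F ∧ z ≤ y} with hZ
    have h1 : ∀ z ∈ Z, s z ∈ Z := fun z hz =>
      ⟨(hs z).2 hz.1, hys ▸ s.monotone hz.2⟩
    have h2 : ∀ z ∈ Z, s.symm z ∈ Z := fun z hz =>
      ⟨(hs' z).2 hz.1, hys' ▸ s.symm.monotone hz.2⟩
    refine ⟨sSup Z, ⟨hx.1.trans_le (le_sSup ⟨hxF, hxy⟩),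
      (sSup_le fun z hz => hz.2).trans_lt hy.2⟩, (hF Z fun z hz => hz.1).1, le_antisymm ?_ ?_⟩
    · rw [← OrderIso.le_symm_apply]
      exact sSup_le fun z hz => (OrderIso.le_symm_apply s).2 (le_sSup (h1 z hz))
    · exact sSup_le fun z hz => (OrderIso.symm_apply_le s).1 (le_sSup (h2 z hz))
  · set Z := {z | z ∈ F ∧ y ≤ z} with hZ
    have h1 : ∀ z ∈ Z, s z ∈ Z := fun z hz =>
      ⟨(hs z).2 hz.1, hys ▸ s.monotone hz.2⟩
    have h2 : ∀ z ∈ Z, s.symm z ∈ Z := fun z hz =>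
      ⟨(hs' z).2 hz.1, hys' ▸ s.symm.monotone hz.2⟩
    refine ⟨sInf Z, ⟨hy.1.trans_le (le_sInf fun z hz => hz.2),
      (sInf_le (show x ∈ Z from ⟨hxF, hxy⟩)).trans_lt hx.2⟩, (hF Z fun z hz => hz.1).2, le_antisymm ?_ ?_⟩
    · exact le_sInf fun z hz => (OrderIso.le_symm_apply s).1 (sInf_le (h2 z hz))
    · rw [← OrderIso.symm_apply_le]
      exact le_sInf fun z hz => (OrderIso.symm_apply_le s).2 (sInf_le (h1 z hz))

theorem fixedPoints_sSup_sInf {ι : Type*} {S : Set ι} {R : ι → I ≃o I} {Z : Set I}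
    (hZ : Z ⊆ {x | ∀ m ∈ S, R m x = x}) :
    sSup Z ∈ {x | ∀ m ∈ S, R m x = x} ∧ sInf Z ∈ {x | ∀ m ∈ S, R m x = x} := by
  have h1 : ∀ m ∈ S, ∀ z ∈ Z, (R m).symm z = z := fun m hm z hz => by
    rw [OrderIso.symm_apply_eq, hZ hz m hm]
  refine ⟨fun m hm => le_antisymm ?_ ?_, fun m hm => le_antisymm ?_ ?_⟩
  · rw [← OrderIso.le_symm_apply]
    exact sSup_le fun z hz => (OrderIso.le_symm_apply _).2 ((hZ hz m hm).le.trans (le_sSup hz))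
  · exact sSup_le fun z hz => (OrderIso.symm_apply_le _).1 ((h1 m hm z hz).le.trans (le_sSup hz))
  · exact le_sInf fun z hz => (OrderIso.le_symm_apply _).1 ((sInf_le hz).trans (h1 m hm z hz).ge)
  · rw [← OrderIso.symm_apply_le]
    exact le_sInf fun z hz => (OrderIso.symm_apply_le _).2 ((sInf_le hz).trans (hZ hz m hm).ge)

theorem exists_common_fixed_point_of_finite {ι : Type*} {R : ι → I ≃o I}
    (hR : ∀ m n x, R m (R n x) = R n (R m x)) {p q : I} (hpq : p < q) (S : Finset ι)
    (hS : ∀ m ∈ S, ∃ x ∈ Set.Ioo p q, R m x = x) :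
    ∃ x ∈ Set.Ioo p q, ∀ m ∈ S, R m x = x := by
  classical
  induction S using Finset.induction_on with
  | empty =>
    obtain ⟨x, hx⟩ := exists_between hpq
    exact ⟨x, hx, by simp⟩
  | insert s S _ ih =>
    obtain ⟨x, hx, hxS⟩ := ih fun m hm => hS m (Finset.mem_insert_of_mem hm)
    obtain ⟨y, hy, hys⟩ := hS s (Finset.mem_insert_self s S)
    obtain ⟨z, hz, hzS, hzs⟩ := common_fixed_point (F := {x | ∀ m ∈ (S : Set ι), R m x = x})
      (fun Z hZ => fixedPoints_sSup_sInf hZ) (s := R s)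
      (fun z => forall₂_congr fun m _ => by rw [hR, (R s).injective.eq_iff]) hx
      (fun m hm => hxS m hm) hy hys
    refine ⟨z, hz, fun m hm => ?_⟩
    rcases Finset.mem_insert.1 hm with rfl | hm
    · exact hzs
    · exact hzS m hm

theorem lt_or_lt_of_no_fixed_point {f : I ≃o I} {p q : I}
    (hf : ∀ x ∈ Set.Ioo p q, f x ≠ x) :
    (∀ x ∈ Set.Ioo p q, x < f x) ∨ ∀ x ∈ Set.Ioo p q, f x < x := by
  by_contra! h
  obtain ⟨⟨x, hx, hxf⟩, y, hy, hyf⟩ := h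
  obtain ⟨z, hz, hzf⟩ := isPreconnected_Ioo.intermediate_value₂ hx hy
    f.continuous.continuousOn continuousOn_id hxf hyf
  exact hf z hz hzf

theorem mapsTo_Ioo {f : I ≃o I} {p q : I} (hp : f p = p) (hq : f q = q) {x : I}
    (hx : x ∈ Set.Ioo p q) : f x ∈ Set.Ioo p q :=
  ⟨hp ▸ f.strictMono hx.1, hq ▸ f.strictMono hx.2⟩

theorem pow_mem_Ioo {f : I ≃o I} {p q : I} (hp : f p = p) (hq : f q = q) {x : I}
    (hx : x ∈ Set.Ioo p q) (n : ℕ) : (f ^ n) x ∈ Set.Ioo p q := by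
  induction n with
  | zero => simpa using hx
  | succ n ih => rw [pow_succ']; exact mapsTo_Ioo hp hq ih

theorem inv_fixed {f : I ≃o I} {p : I} (hp : f p = p) : f⁻¹ p = p := by
  change f.symm p = p
  rw [OrderIso.symm_apply_eq, hp]

theorem zpow_mem_Ioo {f : I ≃o I} {p q : I} (hp : f p = p) (hq : f q = q) {x : I}
    (hx : x ∈ Set.Ioo p q) (n : ℤ) : (f ^ n) x ∈ Set.Ioo p q := by
  cases n with
  | ofNat n => simpa using pow_mem_Ioo hp hq hx n
  | negSucc n =>
    rw [zpow_negSucc, ← inv_pow]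
    exact pow_mem_Ioo (inv_fixed hp) (inv_fixed hq) hx _

theorem exists_lt_pow {f : I ≃o I} {p q : I} (hf : ∀ x ∈ Set.Ioo p q, x < f x) {c z : I}
    (hc : c ∈ Set.Ioo p q) (hz : z ∈ Set.Ioo p q) : ∃ n : ℕ, z < (f ^ n) c := by
  by_contra! h
  set s := ⨆ n : ℕ, (f ^ n) c with hs
  have hcs : c ≤ s := le_iSup (fun n : ℕ => (f ^ n) c) 0
  have hsz : s ≤ z := iSup_le h
  have hfs : f s ≤ s := by
    rw [← OrderIso.le_symm_apply]
    refine iSup_le fun n => ?_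
    rw [OrderIso.le_symm_apply]
    have := le_iSup (fun n : ℕ => (f ^ n) c) (n + 1)
    rwa [pow_succ'] at this
  exact absurd (hf s ⟨hc.1.trans_le hcs, hsz.trans_lt hz.2⟩) (not_lt.2 hfs)

theorem lt_iff_inv_lt {f : I ≃o I} {x y : I} : f⁻¹ x < y ↔ x < f y :=
  (OrderIso.symm_apply_lt f)

/-- An increasing homeomorphism without fixed points on an interval is conjugate there to the
translation by `1`. -/
theorem exists_conj_translation {f : I ≃o I} {p q : I} (hpq : p < q) (hp : f p = p) (hq : f q = q)
    (hf : ∀ x ∈ Set.Ioo p q, x < f x) :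
    ∃ θ : ℝ → I, StrictMono θ ∧ Set.range θ = Set.Ioo p q ∧ ∀ x, θ (x + 1) = f (θ x) := by
  obtain ⟨c, hc⟩ := exists_between hpq
  have hcf : (c : ℝ) < f c := hf c hc
  let g : ℝ → I := fun t => Set.projIcc 0 1 zero_le_one (c + t * (f c - c))
  have hgval : ∀ t ∈ Set.Icc (0 : ℝ) 1, (g t : ℝ) = c + t * (f c - c) := by
    intro t ht
    have h0 := c.2.1
    have h1 := (f c).2.2
    change ((Set.projIcc 0 1 zero_le_one _ : I) : ℝ) = _
    rw [Set.projIcc_of_mem zero_le_one]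
    constructor <;> nlinarith [ht.1, ht.2]
  have hg0 : g 0 = c := by
    apply Subtype.ext
    rw [hgval 0 (by simp)]; ring
  have hg1 : g 1 = f c := by
    apply Subtype.ext
    rw [hgval 1 (by simp)]; ring
  have hgmono : ∀ s ∈ Set.Icc (0 : ℝ) 1, ∀ t ∈ Set.Icc (0 : ℝ) 1, s < t → g s < g t := by
    intro s hs t ht hst
    rw [← Subtype.coe_lt_coe, hgval s hs, hgval t ht]
    nlinarith
  have hfr : ∀ x : ℝ, Int.fract x ∈ Set.Icc (0 : ℝ) 1 := fun x =>
    ⟨Int.fract_nonneg x, (Int.fract_lt_one x).le⟩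
  let θ : ℝ → I := fun x => (f ^ ⌊x⌋) (g (Int.fract x))
  have hglow : ∀ x : ℝ, c ≤ g (Int.fract x) := by
    intro x
    rcases (Int.fract_nonneg x).eq_or_lt with h | h
    · rw [← h, hg0]
    · rw [← hg0]; exact (hgmono 0 (by simp) _ (hfr x) h).le
  have hghigh : ∀ x : ℝ, g (Int.fract x) < f c := by
    intro x
    rw [← hg1]; exact hgmono _ (hfr x) 1 (by simp) (Int.fract_lt_one x)
  have hzmono : Monotone fun n : ℤ => (f ^ n) c := by
    refine monotone_int_of_le_succ fun n => ?_
    rw [zpow_add_one]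
    exact (f ^ n).monotone (hf c hc).le
  have hθmono : StrictMono θ := by
    intro x y hxy
    rcases (Int.floor_mono hxy.le).eq_or_lt with h | h
    · have : Int.fract x < Int.fract y := by
        rw [Int.fract, Int.fract, h]; linarith
      change (f ^ ⌊x⌋) _ < (f ^ ⌊y⌋) _
      rw [h]
      exact (f ^ ⌊y⌋).strictMono (hgmono _ (hfr x) _ (hfr y) this)
    · calc (f ^ ⌊x⌋) (g (Int.fract x)) < (f ^ ⌊x⌋) (f c) := (f ^ ⌊x⌋).strictMono (hghigh x)
        _ = (f ^ (⌊x⌋ + 1)) c := by rw [zpow_add_one]; rfl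
        _ ≤ (f ^ ⌊y⌋) c := hzmono h
        _ ≤ (f ^ ⌊y⌋) (g (Int.fract y)) := (f ^ ⌊y⌋).monotone (hglow y)
  refine ⟨θ, hθmono, Set.Subset.antisymm ?_ ?_, ?_⟩
  · rintro _ ⟨x, rfl⟩
    refine zpow_mem_Ioo hp hq ⟨hc.1.trans_le (hglow x), (hghigh x).trans ?_⟩ _
    exact (mapsTo_Ioo hp hq hc).2
  · intro z hz
    obtain ⟨n, hn, hmax⟩ := Int.exists_greatest_of_bdd (P := fun n : ℤ => (f ^ n) c ≤ z) (by
      obtain ⟨N, hN⟩ := exists_lt_pow hf hc hz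
      refine ⟨N, fun m hm => ?_⟩
      by_contra! hlt
      have : (f ^ (N : ℤ)) c ≤ (f ^ m) c := hzmono hlt.le
      rw [zpow_natCast] at this
      exact absurd (this.trans hm) (not_le.2 hN)) (by
      obtain ⟨N, hN⟩ := exists_lt_pow hf hz hc
      refine ⟨-N, ?_⟩
      rw [zpow_neg, zpow_natCast]
      exact (lt_iff_inv_lt.2 hN).le)
    have hn1 : z < (f ^ (n + 1)) c := by
      by_contra! h
      have := hmax _ h
      lia
    set w := (f ^ n)⁻¹ z with hw
    have hwz : (f ^ n) w = z := (f ^ n).apply_symm_apply z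
    have hcw : c ≤ w := (OrderIso.le_symm_apply (f ^ n)).2 hn
    have hwf : w < f c := by
      refine lt_iff_inv_lt.2 ?_
      rwa [zpow_add_one] at hn1
    have hcw' : (c : ℝ) ≤ w := hcw
    have hwf' : (w : ℝ) < f c := hwf
    have hpos : (0 : ℝ) < f c - c := sub_pos.2 hcf
    set t : ℝ := (w - c) / (f c - c) with ht
    have ht0 : 0 ≤ t := div_nonneg (sub_nonneg.2 hcw') hpos.le
    have ht1 : t < 1 := (div_lt_one hpos).2 (by linarith)
    refine ⟨n + t, ?_⟩
    have hfl : ⌊(n : ℝ) + t⌋ = n := by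
      rw [Int.floor_intCast_add, Int.floor_eq_zero_iff.2 ⟨ht0, ht1⟩, add_zero]
    have hfrac : Int.fract ((n : ℝ) + t) = t := by
      rw [Int.fract, hfl]; ring
    change (f ^ ⌊(n : ℝ) + t⌋) (g (Int.fract ((n : ℝ) + t))) = z
    rw [hfl, hfrac, ← hwz]
    congr 1
    apply Subtype.ext
    rw [hgval t ⟨ht0, ht1.le⟩, ht, div_mul_cancel₀ _ hpos.ne']
    ring
  · intro x
    change (f ^ ⌊x + 1⌋) (g (Int.fract (x + 1))) = f ((f ^ ⌊x⌋) (g (Int.fract x)))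
    rw [Int.floor_add_one, Int.fract_add_one, add_comm ⌊x⌋ 1, zpow_one_add]
    rfl

end Order

section TranslationNumber

variable {M : Type*} [AddCommGroup M] {R : M → I ≃o I}

theorem action_zero (hR : ∀ m n, R (m + n) = R m * R n) : R 0 = 1 := by
  have := hR 0 0
  rwa [add_zero, left_eq_mul] at this

theorem action_neg (hR : ∀ m n, R (m + n) = R m * R n) (m : M) : R (-m) = (R m)⁻¹ := by
  rw [eq_inv_iff_mul_eq_one, ← hR, neg_add_cancel, action_zero hR]

theorem action_nsmul (hR : ∀ m n, R (m + n) = R m * R n) (k : ℕ) (m : M) :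
    R (k • m) = (R m) ^ k := by
  induction k with
  | zero => rw [zero_smul, action_zero hR, pow_zero]
  | succ k ih => rw [succ_nsmul, hR, ih, pow_succ]

theorem action_comm (hR : ∀ m n, R (m + n) = R m * R n) (m n : M) (x : I) :
    R m (R n x) = R n (R m x) := by
  have : R m * R n = R n * R m := by rw [← hR, ← hR, add_comm]
  exact DFunLike.congr_fun this x

theorem fixed_of_pow_fixed {f : I ≃o I} {x : I} {n : ℕ} (hn : 0 < n) (h : (f ^ n) x = x) :
    f x = x := by
  have hpow : ∀ g : I ≃o I, x < g x → ∀ n : ℕ, 0 < n → x < (g ^ n) x := by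
    intro g hg n hn
    induction n, hn using Nat.le_induction with
    | base => simpa using hg
    | succ n _ ih =>
      rw [pow_succ']
      exact hg.trans (g.strictMono ih)
  rcases lt_trichotomy (f x) x with h1 | h1 | h1
  · have h2 := hpow f⁻¹ ((OrderIso.lt_symm_apply f).2 h1) n hn
    rw [inv_pow] at h2
    have h3 : (f ^ n)⁻¹ x = x := inv_fixed h
    exact absurd h3 h2.ne'
  · exact h1
  · exact absurd h (hpow f h1 n hn).ne'

theorem fixed_of_fixed_generators (hR : ∀ m n, R (m + n) = R m * R n) {S : Set M}
    (hS : ∀ m : M, ∃ N : ℕ, 0 < N ∧ N • m ∈ AddSubgroup.closure S) {x : I}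
    (hx : ∀ m ∈ S, R m x = x) (m : M) : R m x = x := by
  obtain ⟨N, hN, hm⟩ := hS m
  refine fixed_of_pow_fixed hN ?_
  rw [← action_nsmul hR]
  generalize N • m = y at hm
  induction hm using AddSubgroup.closure_induction with
  | mem y hy => exact hx y hy
  | zero => rw [action_zero hR]; rfl
  | add y z _ _ hy hz => rw [hR]; change R y (R z x) = x; rw [hz, hy]
  | neg y _ hy => rw [action_neg hR]; exact inv_fixed hy

/-- Translation numbers for an abelian group of finite rank acting on an interval without common
fixed points. -/
theorem exists_translationNumber (hR : ∀ m n, R (m + n) = R m * R n) {S : Finset M}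
    (hS : ∀ m : M, ∃ N : ℕ, 0 < N ∧ N • m ∈ AddSubgroup.closure (S : Set M)) {p q : I}
    (hpq : p < q) (hp : ∀ m, R m p = p) (hq : ∀ m, R m q = q)
    (hfix : ∀ x ∈ Set.Ioo p q, ∃ m, R m x ≠ x) :
    ∃ τ : M →+ ℝ, τ ≠ 0 ∧ ∀ m, 0 < τ m → ∀ x ∈ Set.Ioo p q, x < R m x := by
  obtain ⟨s, hs⟩ : ∃ s, ∀ x ∈ Set.Ioo p q, R s x ≠ x := by
    by_contra! h
    obtain ⟨x, hx, hxS⟩ := exists_common_fixed_point_of_finite (action_comm hR) hpq S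
      fun m _ => h m
    obtain ⟨m, hm⟩ := hfix x hx
    exact hm (fixed_of_fixed_generators hR hS hxS m)
  obtain ⟨f, hf⟩ : ∃ f, ∀ x ∈ Set.Ioo p q, x < R f x := by
    rcases lt_or_lt_of_no_fixed_point hs with h | h
    · exact ⟨s, h⟩
    · refine ⟨-s, fun x hx => ?_⟩
      rw [action_neg hR]
      exact (OrderIso.lt_symm_apply _).2 (h x hx)
  obtain ⟨θ, hθ, hrange, hθf⟩ := exists_conj_translation hpq (hp f) (hq f) hf
  have hmem : ∀ (m : M) (x : ℝ), ∃ y, θ y = R m (θ x) := by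
    intro m x
    have : θ x ∈ Set.Ioo p q := hrange ▸ Set.mem_range_self x
    have := mapsTo_Ioo (hp m) (hq m) this
    rwa [← hrange] at this
  choose L hL using hmem
  let T : M → CircleDeg1Lift := fun m =>
    { toFun := L m
      monotone' := fun x y hxy => by
        rw [← hθ.le_iff_le, hL, hL]
        exact (R m).monotone (hθ.monotone hxy)
      map_add_one' := fun x => by
        apply hθ.injective
        rw [hL, hθf, hθf, hL, action_comm hR] }
  have hT : ∀ m n, T (m + n) = T m * T n := by
    intro m n
    ext x
    apply hθ.injective
    change θ (L (m + n) x) = θ (L m (L n x))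
    rw [hL, hL, hL, hR]
    rfl
  refine ⟨AddMonoidHom.mk' (fun m => CircleDeg1Lift.translationNumber (T m)) fun m n => ?_,
    ?_, ?_⟩
  · rw [hT]
    refine CircleDeg1Lift.translationNumber_mul_of_commute ?_
    change T m * T n = T n * T m
    rw [← hT, ← hT, add_comm]
  · intro h
    have h1 : CircleDeg1Lift.translationNumber (T f) = 0 := DFunLike.congr_fun h f
    have h2 : T f 0 = 0 + ((1 : ℤ) : ℝ) := by
      apply hθ.injective
      change θ (L f 0) = _
      rw [hL, ← hθf]
      simp
    rw [CircleDeg1Lift.translationNumber_of_eq_add_int _ h2] at h1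
    norm_num at h1
  · intro m hm x hx
    rw [← hrange] at hx
    obtain ⟨y, rfl⟩ := hx
    have := CircleDeg1Lift.lt_map_of_int_lt_translationNumber (T m) (n := 0)
      (by simpa using hm) y
    rw [← hL]
    apply hθ
    rw [Int.cast_zero, add_zero] at this
    exact this

end TranslationNumber

section StrictDerivative

open Filter Topology

/-- `f` has strict derivative `c` at `e`, as a function on the unit interval. -/
def HasStrictDerivI (f : I → I) (c : ℝ) (e : I) : Prop :=
  ∀ ε : ℝ, 0 < ε → ∃ U ∈ 𝓝 e, ∀ x ∈ U, ∀ y ∈ U,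
    |(f x : ℝ) - f y - c * (x - y)| ≤ ε * |(x : ℝ) - y|

theorem IsC1.exists_hasStrictDerivI {f : I → I} (hf : IsC1 f) (e : I) :
    ∃ c, HasStrictDerivI f c e := by
  set F : ℝ → ℝ := fun x => (f (Set.projIcc (0 : ℝ) 1 zero_le_one x) : ℝ) with hF
  have hFf : ∀ x : I, F x = f x := fun x => by simp [hF]
  have hd : ∀ x ∈ Set.Icc (0 : ℝ) 1,
      HasDerivWithinAt F (derivWithin F (Set.Icc 0 1) x) (Set.Icc 0 1) x := fun x hx =>
    ((hf.differentiableOn one_ne_zero) x hx).hasDerivWithinAt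
  have hc : ContinuousOn (derivWithin F (Set.Icc 0 1)) (Set.Icc 0 1) :=
    hf.continuousOn_derivWithin (uniqueDiffOn_Icc zero_lt_one) le_rfl
  set c := derivWithin F (Set.Icc 0 1) e with hcdef
  refine ⟨c, fun ε hε => ?_⟩
  have h1 := hc e e.2
  obtain ⟨δ, hδ, hball⟩ := Metric.continuousWithinAt_iff.1 h1 ε hε
  refine ⟨Metric.ball e δ, Metric.ball_mem_nhds _ hδ, fun x hx y hy => ?_⟩
  have hconv : Convex ℝ (Metric.ball (e : ℝ) δ ∩ Set.Icc 0 1) :=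
    (convex_ball _ _).inter (convex_Icc _ _)
  have := hconv.norm_image_sub_le_of_norm_hasDerivWithin_le
    (f := fun t => F t - c * t) (f' := fun t => derivWithin F (Set.Icc 0 1) t - c * 1) (C := ε)
    (x := y) (y := x)
    (fun t ht => ((hd t ht.2).mono Set.inter_subset_right).sub
      ((hasDerivWithinAt_id t _).const_mul c))
    (fun t ht => by
      rw [mul_one]
      exact (hball ht.2 ht.1).le)
    ⟨hy, y.2⟩ ⟨hx, x.2⟩
  rw [Real.norm_eq_abs, Real.norm_eq_abs] at this
  simp only [hFf] at this
  convert this using 2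
  ring

theorem hasStrictDerivI_id (e : I) : HasStrictDerivI id 1 e := fun ε hε =>
  ⟨Set.univ, univ_mem, fun x _ y _ => by simpa using by positivity⟩

theorem HasStrictDerivI.comp {f g : I → I} {c d : ℝ} {e : I} (hf : HasStrictDerivI f c e)
    (hg : HasStrictDerivI g d e) (hgc : ContinuousAt g e) (hge : g e = e) :
    HasStrictDerivI (f ∘ g) (c * d) e := by
  intro ε hε
  set η := min 1 (ε / (|c| + |d| + 1)) with hη
  have hpos : 0 < |c| + |d| + 1 := by positivity
  have hη0 : 0 < η := lt_min one_pos (div_pos hε hpos)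
  have hη1 : η ≤ 1 := min_le_left _ _
  have hη2 : η * (|c| + |d| + 1) ≤ ε := by
    rw [← le_div_iff₀ hpos]; exact min_le_right _ _
  obtain ⟨U, hU, h1⟩ := hf η hη0
  obtain ⟨V, hV, h2⟩ := hg η hη0
  refine ⟨V ∩ g ⁻¹' U, inter_mem hV (hgc (by rwa [hge])), fun x hx y hy => ?_⟩
  have h3 := h1 _ hx.2 _ hy.2
  have h4 := h2 x hx.1 y hy.1
  set A := (f (g x) : ℝ) - f (g y) - c * (g x - g y)
  set B := (g x : ℝ) - g y - d * (x - y) with hB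
  have h5 : |(g x : ℝ) - g y| ≤ (|d| + η) * |(x : ℝ) - y| := by
    have : (g x : ℝ) - g y = d * (x - y) + B := by rw [hB]; ring
    rw [this, add_mul, ← abs_mul]
    exact (abs_add_le _ _).trans (add_le_add le_rfl h4)
  calc |((f ∘ g) x : ℝ) - (f ∘ g) y - c * d * (x - y)| = |A + c * B| := by
        congr 1; simp only [A, B, Function.comp]; ring
    _ ≤ |A| + |c| * |B| := (abs_add_le _ _).trans (by rw [abs_mul])
    _ ≤ η * ((|d| + 1) * |(x : ℝ) - y|) + |c| * (η * |(x : ℝ) - y|) := by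
        gcongr
        refine h3.trans ?_
        gcongr
        refine h5.trans ?_
        gcongr
    _ = η * (|c| + |d| + 1) * |(x : ℝ) - y| := by ring
    _ ≤ ε * |(x : ℝ) - y| := by gcongr

theorem exists_ne_mem_of_mem_nhds {e : I} {U : Set I} (hU : U ∈ 𝓝 e) : ∃ x ∈ U, x ≠ e := by
  have : (𝓝[≠] e).NeBot := inferInstance
  obtain ⟨x, hx⟩ := this.nonempty_of_mem (inter_mem (mem_nhdsWithin_of_mem_nhds hU)
    self_mem_nhdsWithin)
  exact ⟨x, hx.1, hx.2⟩

theorem HasStrictDerivI.unique {f : I → I} {c d : ℝ} {e : I} (hc : HasStrictDerivI f c e)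
    (hd : HasStrictDerivI f d e) : c = d := by
  by_contra hne
  have hpos : 0 < |c - d| := abs_pos.2 (sub_ne_zero.2 hne)
  obtain ⟨U, hU, h1⟩ := hc (|c - d| / 3) (by positivity)
  obtain ⟨V, hV, h2⟩ := hd (|c - d| / 3) (by positivity)
  obtain ⟨x, hx, hxe⟩ := exists_ne_mem_of_mem_nhds (inter_mem hU hV)
  have h3 := h1 x hx.1 e (mem_of_mem_nhds hU)
  have h4 := h2 x hx.2 e (mem_of_mem_nhds hV)
  have hxe' : 0 < |(x : ℝ) - e| := abs_pos.2 (sub_ne_zero.2 fun h => hxe (Subtype.ext h))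
  have h5 : |c - d| * |(x : ℝ) - e| ≤
      |c - d| / 3 * |(x : ℝ) - e| + |c - d| / 3 * |(x : ℝ) - e| := by
    rw [← abs_mul]
    calc |(c - d) * ((x : ℝ) - e)|
        = |((f x : ℝ) - f e - d * (x - e)) - ((f x : ℝ) - f e - c * (x - e))| := by
          congr 1; ring
      _ ≤ _ := (abs_sub _ _).trans (by linarith)
  nlinarith [mul_pos hpos hxe']

theorem HasStrictDerivI.pos {f : I ≃o I} {c d : ℝ} {e : I} (hf : HasStrictDerivI f c e)
    (hf' : HasStrictDerivI f.symm d e) (he : f e = e) : 0 < c := by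
  have h1 : c * d = 1 := by
    have := hf.comp hf' f.symm.continuous.continuousAt (by rw [OrderIso.symm_apply_eq, he])
    rw [show (f : I → I) ∘ f.symm = id from funext fun x => f.apply_symm_apply x] at this
    exact this.unique (hasStrictDerivI_id e)
  have hc0 : c ≠ 0 := fun h => by simp [h] at h1
  by_contra! hneg
  have hneg := lt_of_le_of_ne hneg hc0
  obtain ⟨U, hU, h2⟩ := hf (-c / 2) (by linarith)
  obtain ⟨x, hx, hxe⟩ := exists_ne_mem_of_mem_nhds hU
  have h3 := h2 x hx e (mem_of_mem_nhds hU)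
  rcases lt_or_gt_of_ne hxe with h | h
  · have h4 : (f x : ℝ) < f e := f.strictMono h
    have h : (x : ℝ) < e := h
    rw [abs_of_neg (by linarith : (x : ℝ) - e < 0)] at h3
    have := (abs_le.1 h3).1
    nlinarith
  · have h4 : (f e : ℝ) < f x := f.strictMono h
    have h : (e : ℝ) < x := h
    rw [abs_of_pos (by linarith : 0 < (x : ℝ) - e)] at h3
    have := (abs_le.1 h3).2
    nlinarith

variable {M : Type*} [AddCommGroup M] {R : M → I ≃o I} {α : M ≃+ M} {a : I ≃o I}

/-- The derivatives at a common fixed point of the elements of a group without subexponential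
functionals are trivial. -/
theorem hasStrictDerivI_one (hR : ∀ m n, R (m + n) = R m * R n)
    (ha : ∀ m x, a (R m x) = R (α m) (a x)) (hα : ∀ τ : M →+ ℝ, IsSubexp α τ → τ = 0) {e : I}
    (he : ∀ m, R m e = e) (hae : a e = e) (hR1 : ∀ m, ∃ c, HasStrictDerivI (R m) c e)
    (ha1 : ∃ c, HasStrictDerivI a c e) (ha2 : ∃ c, HasStrictDerivI a.symm c e) (m : M) :
    HasStrictDerivI (R m) 1 e := by
  choose c hc using hR1
  obtain ⟨u, hu⟩ := ha1
  obtain ⟨v, hv⟩ := ha2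
  have hu0 := hu.pos hv hae
  have hcpos : ∀ m, 0 < c m := fun m => (hc m).pos (d := c (-m)) (by
    have := hc (-m); rw [action_neg hR] at this; exact this) (he m)
  have hcadd : ∀ m n, c (m + n) = c m * c n := fun m n => by
    have h1 := (hc m).comp (hc n) (R n).continuous.continuousAt (he n)
    have h2 := hc (m + n)
    rw [hR] at h2
    exact h2.unique h1
  have hcα : ∀ m, c (α m) = c m := fun m => by
    have h1 := hu.comp (hc m) (R m).continuous.continuousAt (he m)
    have h2 := (hc (α m)).comp hu a.continuous.continuousAt hae
    rw [show (R (α m) : I → I) ∘ a = a ∘ R m from funext fun x => (ha m x).symm] at h2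
    have := h1.unique h2
    rw [mul_comm] at this
    exact (mul_right_cancel₀ hu0.ne' this).symm
  let τ : M →+ ℝ := AddMonoidHom.mk' (fun m => Real.log (c m)) fun m n => by
    rw [hcadd, Real.log_mul (hcpos m).ne' (hcpos n).ne']
  have hτ0 : τ = 0 := hα τ (isSubexp_of_map_eq fun m => congrArg Real.log (hcα m))
  have h1 : Real.log (c m) = 0 := DFunLike.congr_fun hτ0 m
  have h2 : c m = 1 := Real.eq_one_of_pos_of_log_eq_zero (hcpos m) h1
  rw [← h2]
  exact hc m

end StrictDerivative

section Displacement

open Filter Topology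

variable {M : Type*} [AddCommGroup M]

/-- The displacement of `y` under `R m`. -/
def displ (R : M → I ≃o I) (m : M) (y : I) : ℝ := (R m y : ℝ) - y

/-- The functional `τ` is compatible with the action `R` at `y`: it is positive only on elements
that move `y` to the right. -/
def IsSignCompat (R : M → I ≃o I) (τ : M →+ ℝ) (y : I) : Prop := ∀ m, 0 < τ m → y < R m y

variable {R : M → I ≃o I}

theorem IsSignCompat.displ_pos {τ : M →+ ℝ} {y : I} (h : IsSignCompat R τ y) {m : M}
    (hm : 0 < τ m) : 0 < displ R m y := sub_pos.2 (h m hm)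

theorem IsSignCompat.displ_neg {τ : M →+ ℝ} {y : I} (hR : ∀ m n, R (m + n) = R m * R n)
    (h : IsSignCompat R τ y) {m : M} (hm : τ m < 0) : displ R m y < 0 := by
  have := h (-m) (by rw [map_neg]; linarith)
  rw [action_neg hR] at this
  exact sub_neg.2 ((OrderIso.lt_symm_apply _).1 this)

variable {e : I}

theorem displ_add (hR : ∀ m n, R (m + n) = R m * R n) (he : ∀ m, R m e = e)
    (h1 : ∀ m, HasStrictDerivI (R m) 1 e) (m n : M) {ε : ℝ} (hε : 0 < ε) :
    ∀ᶠ y in 𝓝 e, |displ R (m + n) y - displ R m y - displ R n y| ≤ ε * |displ R n y| := by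
  obtain ⟨U, hU, h⟩ := h1 m ε hε
  have h2 : ∀ᶠ y in 𝓝 e, R n y ∈ U :=
    (R n).continuous.continuousAt (by rwa [he])
  filter_upwards [hU, h2] with y hy1 hy2
  have := h _ hy2 _ hy1
  simp only [displ, hR]
  convert this using 2
  change ((R m (R n y) : I) : ℝ) - _ - _ - _ = _
  ring

theorem displ_zsmul (hR : ∀ m n, R (m + n) = R m * R n) (he : ∀ m, R m e = e)
    (h1 : ∀ m, HasStrictDerivI (R m) 1 e) (k : ℤ) (n : M) :
    ∀ ε : ℝ, 0 < ε → ∀ᶠ y in 𝓝 e, |displ R (k • n) y - k * displ R n y| ≤ ε * |displ R n y| := by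
  induction k with
  | zero =>
    intro ε hε
    filter_upwards with y
    simp only [zero_smul, displ, action_zero hR]
    simpa using by positivity
  | succ k ih =>
    intro ε hε
    filter_upwards [ih (ε / 2) (half_pos hε), displ_add hR he h1 ((k : ℤ) • n) n (half_pos hε)]
      with y hy1 hy2
    rw [add_zsmul, one_zsmul]
    have : displ R ((k : ℤ) • n + n) y - ((k + 1 : ℤ) : ℝ) * displ R n y =
        (displ R ((k : ℤ) • n + n) y - displ R ((k : ℤ) • n) y - displ R n y) +
        (displ R ((k : ℤ) • n) y - ((k : ℤ) : ℝ) * displ R n y) := by push_cast; ring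
    rw [this]
    refine (abs_add_le _ _).trans ((add_le_add hy2 hy1).trans (le_of_eq (by ring)))
  | pred k ih =>
    intro ε hε
    filter_upwards [ih (ε / 2) (half_pos hε),
      displ_add hR he h1 ((-(k : ℤ) - 1) • n) n (half_pos hε)] with y hy1 hy2
    have hk : (-(k : ℤ) - 1) • n + n = (-(k : ℤ)) • n := by
      rw [sub_zsmul, one_zsmul]; abel
    rw [hk] at hy2
    have : displ R ((-(k : ℤ) - 1) • n) y - ((-(k : ℤ) - 1 : ℤ) : ℝ) * displ R n y =
        (displ R ((-(k : ℤ)) • n) y - ((-(k : ℤ) : ℤ) : ℝ) * displ R n y) -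
        (displ R ((-(k : ℤ)) • n) y - displ R ((-(k : ℤ) - 1) • n) y - displ R n y) := by
      push_cast; ring
    rw [this]
    refine (abs_sub _ _).trans ((add_le_add hy1 hy2).trans (le_of_eq (by ring)))

theorem displ_sub_zsmul (hR : ∀ m n, R (m + n) = R m * R n) (he : ∀ m, R m e = e)
    (h1 : ∀ m, HasStrictDerivI (R m) 1 e) (k l : ℤ) (m n : M) {ε : ℝ} (hε : 0 < ε) :
    ∀ᶠ y in 𝓝 e, |displ R (k • m - l • n) y - (k * displ R m y - l * displ R n y)| ≤
      ε * (|displ R m y| + |displ R n y|) := by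
  have hpos : (0 : ℝ) < |(l : ℝ)| + 1 := by positivity
  filter_upwards [displ_zsmul hR he h1 k m (ε / 2) (half_pos hε),
    displ_zsmul hR he h1 (-l) n (min (ε / 2) 1) (lt_min (half_pos hε) one_pos),
    displ_add hR he h1 (k • m) ((-l) • n) (div_pos (half_pos hε) hpos)] with y h2 h3 h4
  rw [neg_zsmul, ← sub_eq_add_neg] at h4
  rw [neg_zsmul] at h3
  push_cast at h3
  set A := displ R m y
  set B := displ R n y
  set B' := displ R (-(l • n)) y
  set A' := displ R (k • m) y
  have h5 : |B'| ≤ (|(l : ℝ)| + 1) * |B| := by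
    have h6 : B' = -(l : ℝ) * B + (B' - -(l : ℝ) * B) := by ring
    rw [h6, add_mul, ← abs_mul, ← abs_neg ((l : ℝ) * B), ← neg_mul]
    exact (abs_add_le _ _).trans (add_le_add le_rfl
      (h3.trans (mul_le_mul_of_nonneg_right (min_le_right _ _) (abs_nonneg _))))
  have h6 : ε / 2 / (|(l : ℝ)| + 1) * |B'| ≤ ε / 2 * |B| := by
    calc _ ≤ ε / 2 / (|(l : ℝ)| + 1) * ((|(l : ℝ)| + 1) * |B|) := by gcongr
      _ = ε / 2 * |B| := by field_simp
  have h7 : |B' - -(l : ℝ) * B| ≤ ε / 2 * |B| :=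
    h3.trans (mul_le_mul_of_nonneg_right (min_le_left _ _) (abs_nonneg _))
  have h8 : displ R (k • m - l • n) y - (k * A - l * B) =
      (displ R (k • m - l • n) y - A' - B') + ((A' - k * A) + (B' - -(l : ℝ) * B)) := by ring
  rw [h8]
  have h9 := abs_add_le (displ R (k • m - l • n) y - A' - B') ((A' - k * A) + (B' - -(l : ℝ) * B))
  have h10 := abs_add_le (A' - k * A) (B' - -(l : ℝ) * B)
  nlinarith [abs_nonneg A]

theorem abs_sub_mul_le_of_floor_bounds {C ε N x z u p E : ℝ} (hC : 0 ≤ C) (hN1 : 1 ≤ N)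
    (hNε : 3 ≤ ε * N) (hz : 0 < z) (hE : E = 1 / (4 * (C + 4)) * (|x| + z)) (hp1 : p ≤ N * u)
    (hp2 : N * u ≤ p + 1) (hp3 : p + 1 ≤ C * N + 2) (hp4 : -(C * N + 2) ≤ p - 1)
    (hl : (p - 1) * z - E ≤ N * x) (hh : N * x ≤ (p + 1) * z + E) :
    |x - u * z| ≤ ε * z := by
  have hx0 := abs_nonneg x
  have hquarter : 1 / (4 * (C + 4)) ≤ (1 : ℝ) / 4 := by
    apply one_div_le_one_div_of_le <;> linarith
  have hE4 : E ≤ 1 / 4 * (|x| + z) := by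
    rw [hE]; gcongr
  have h1 := mul_le_mul_of_nonneg_right hp3 hz.le
  have h2 := mul_le_mul_of_nonneg_right hp4 hz.le
  have hNx : N * |x| ≤ (C * N + 2) * z + E := by
    have : |N * x| ≤ (C * N + 2) * z + E := by
      rw [abs_le]; constructor <;> linarith
    rwa [abs_mul, abs_of_nonneg (by linarith : 0 ≤ N)] at this
  have h3 : |x| ≤ N * |x| := le_mul_of_one_le_left hx0 hN1
  have h4 : z ≤ N * z := le_mul_of_one_le_left hz.le hN1
  have h5 : N * (3 / 4 * |x|) ≤ N * ((C + 3) * z) := by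
    have h6 : N * ((C + 3) * z) = C * N * z + 3 * (N * z) := by ring
    rw [h6]
    linarith
  have hx : 3 / 4 * |x| ≤ (C + 3) * z := le_of_mul_le_mul_left h5 (by linarith)
  have hCz : 0 ≤ C * z := mul_nonneg hC hz.le
  have hE1 : E ≤ z := by
    rw [hE, one_div, inv_mul_le_iff₀ (by positivity)]
    linarith
  have h7 := mul_le_mul_of_nonneg_right hp1 hz.le
  have h8 := mul_le_mul_of_nonneg_right hp2 hz.le
  have h9 := mul_le_mul_of_nonneg_right hNε hz.le
  have hfin : N * |x - u * z| ≤ N * (ε * z) := by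
    have : |N * (x - u * z)| ≤ 3 * z := by
      rw [abs_le]; constructor <;> linarith
    rw [abs_mul, abs_of_nonneg (by linarith : 0 ≤ N)] at this
    linarith
  exact le_of_mul_le_mul_left hfin (by linarith)

/-- Near a fixed point where all derivatives are trivial, the ratios of displacements are close to
the ratios of the values of every compatible functional. -/
theorem displ_ratio (hR : ∀ m n, R (m + n) = R m * R n) (he : ∀ m, R m e = e)
    (h1 : ∀ m, HasStrictDerivI (R m) 1 e) (h f : M) {C ε : ℝ} (hC : 0 ≤ C) (hε : 0 < ε) :
    ∀ᶠ y in 𝓝 e, ∀ τ : M →+ ℝ, IsSignCompat R τ y → 0 < τ f → |τ h| ≤ C * τ f →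
      |displ R h y - τ h / τ f * displ R f y| ≤ ε * displ R f y := by
  obtain ⟨N, hN⟩ := exists_nat_ge (3 / ε + 1)
  have hN1 : (1 : ℝ) ≤ N := by have : 0 < 3 / ε := by positivity
                               linarith
  have hNε : 3 ≤ ε * N := by
    have : 3 / ε ≤ N := by linarith
    rw [div_le_iff₀ hε] at this; linarith
  obtain ⟨P, hP⟩ := exists_nat_ge (C * N + 2)
  have hη : (0 : ℝ) < 1 / (4 * (C + 4)) := by positivity
  have hall : ∀ᶠ y in 𝓝 e, ∀ p ∈ Set.Icc (-(P : ℤ)) P,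
      |displ R ((N : ℤ) • h - p • f) y - (((N : ℤ) : ℝ) * displ R h y - p * displ R f y)| ≤
        1 / (4 * (C + 4)) * (|displ R h y| + |displ R f y|) :=
    (Set.finite_Icc _ _).eventually_all.2 fun p _ => displ_sub_zsmul hR he h1 _ _ _ _ hη
  filter_upwards [hall] with y hy τ hτ hf hhf
  have hDf := hτ.displ_pos hf
  set x := displ R h y
  set z := displ R f y
  set u := τ h / τ f with hu
  have hτh : τ h = u * τ f := by rw [hu, div_mul_cancel₀ _ hf.ne']
  have huC : |u| ≤ C := by
    rw [hu, abs_div, abs_of_pos hf, div_le_iff₀ hf]; exact hhf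
  have huC' := abs_le.1 huC
  set p := ⌊(N : ℝ) * u⌋ with hp
  have hp1 : (p : ℝ) ≤ N * u := Int.floor_le _
  have hp2 : (N : ℝ) * u < p + 1 := Int.lt_floor_add_one _
  have hp3 : (p : ℝ) + 1 ≤ P := by nlinarith
  have hp4 : -(P : ℝ) ≤ p - 1 := by nlinarith
  have hp3' : p + 1 ≤ P := by exact_mod_cast hp3
  have hp4' : -(P : ℤ) ≤ p - 1 := by exact_mod_cast hp4
  have hlow := hy (p - 1) ⟨hp4', by lia⟩
  have hhigh := hy (p + 1) ⟨by lia, hp3'⟩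
  have hpos : 0 < displ R ((N : ℤ) • h - (p - 1) • f) y := by
    refine hτ.displ_pos ?_
    rw [map_sub, map_zsmul, map_zsmul, zsmul_eq_mul, zsmul_eq_mul, hτh]
    push_cast
    nlinarith
  have hneg : displ R ((N : ℤ) • h - (p + 1) • f) y < 0 := by
    refine hτ.displ_neg hR ?_
    rw [map_sub, map_zsmul, map_zsmul, zsmul_eq_mul, zsmul_eq_mul, hτh]
    push_cast
    nlinarith
  push_cast at hlow hhigh
  have hlow' := (abs_le.1 hlow).2
  have hhigh' := (abs_le.1 hhigh).1
  rw [abs_of_pos hDf] at hlow' hhigh'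
  set E := 1 / (4 * (C + 4)) * (|x| + z) with hE
  have hl : ((p : ℝ) - 1) * z - E ≤ N * x := by linarith
  have hh : N * x ≤ ((p : ℝ) + 1) * z + E := by linarith
  exact abs_sub_mul_le_of_floor_bounds hC hN1 hNε hDf hE hp1 hp2.le (by nlinarith) (by nlinarith)
    hl hh

end Displacement

section Growth

open Filter Topology

theorem le_pow_of_tendsto_ratio {u : ℕ → ℝ} (hu : ∀ n, 0 < u n)
    (h : Tendsto (fun n => u (n + 1) / u n) atTop (𝓝 1)) {r : ℝ} (hr : 1 < r) :
    ∃ C : ℝ, ∀ n, u n ≤ C * r ^ n := by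
  obtain ⟨N, hN⟩ := eventually_atTop.1 (h.eventually_lt_const hr)
  refine ⟨∑ k ∈ Finset.range (N + 1), u k, fun n => ?_⟩
  have hnn : ∀ k ∈ Finset.range (N + 1), 0 ≤ u k := fun k _ => (hu k).le
  have hC : 0 ≤ ∑ k ∈ Finset.range (N + 1), u k := Finset.sum_nonneg hnn
  have hsmall : ∀ n ≤ N, u n ≤ (∑ k ∈ Finset.range (N + 1), u k) * r ^ n := fun n hn =>
    (Finset.single_le_sum hnn (Finset.mem_range.2 (by lia))).trans
      (le_mul_of_one_le_right hC (one_le_pow₀ hr.le))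
  rcases le_total n N with hn | hn
  · exact hsmall n hn
  · induction n, hn using Nat.le_induction with
    | base => exact hsmall N le_rfl
    | succ n hn ih =>
      have := (div_lt_iff₀ (hu n)).1 (hN n hn)
      rw [pow_succ]
      nlinarith

variable {M : Type*} [AddCommGroup M] {S : Finset M}

theorem abs_le_of_finite_rank
    (hS : ∀ m : M, ∃ N : ℕ, 0 < N ∧ N • m ∈ AddSubgroup.closure (S : Set M)) (h : M) :
    ∃ C : ℝ, 0 ≤ C ∧ ∀ (τ : M →+ ℝ) (b : ℝ), 0 ≤ b → (∀ s ∈ S, |τ s| ≤ b) → |τ h| ≤ C * b := by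
  obtain ⟨N, hN, hm⟩ := hS h
  have key : ∀ m ∈ AddSubgroup.closure (S : Set M), ∃ C : ℝ, 0 ≤ C ∧ ∀ (τ : M →+ ℝ) (b : ℝ), 0 ≤ b →
      (∀ s ∈ S, |τ s| ≤ b) → |τ m| ≤ C * b := by
    intro m hm
    induction hm using AddSubgroup.closure_induction with
    | mem y hy => exact ⟨1, zero_le_one, fun τ b _ hb => by simpa using hb y hy⟩
    | zero => exact ⟨0, le_rfl, fun τ b _ hb => by simp⟩
    | add y z _ _ hy hz =>
      obtain ⟨C, hC, h1⟩ := hy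
      obtain ⟨D, hD, h2⟩ := hz
      refine ⟨C + D, add_nonneg hC hD, fun τ b hb0 hb => ?_⟩
      rw [map_add, add_mul]
      exact (abs_add_le _ _).trans (add_le_add (h1 τ b hb0 hb) (h2 τ b hb0 hb))
    | neg y _ hy =>
      obtain ⟨C, hC, h1⟩ := hy
      refine ⟨C, hC, fun τ b hb0 hb => ?_⟩
      rw [map_neg, abs_neg]
      exact h1 τ b hb0 hb
  obtain ⟨C, hC, h1⟩ := key _ hm
  refine ⟨C, hC, fun τ b hb0 hb => le_trans ?_ (h1 τ b hb0 hb)⟩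
  rw [map_nsmul, nsmul_eq_mul, abs_mul, Nat.abs_cast]
  exact le_mul_of_one_le_left (abs_nonneg _) (by exact_mod_cast hN)

theorem abs_le_of_finite_rank_of_finite
    (hS : ∀ m : M, ∃ N : ℕ, 0 < N ∧ N • m ∈ AddSubgroup.closure (S : Set M)) (T : Finset M) :
    ∃ C : ℝ, 0 ≤ C ∧ ∀ (τ : M →+ ℝ) (b : ℝ), 0 ≤ b → (∀ s ∈ S, |τ s| ≤ b) →
      ∀ h ∈ T, |τ h| ≤ C * b := by
  choose C hC h1 using abs_le_of_finite_rank hS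
  refine ⟨∑ h ∈ T, C h, Finset.sum_nonneg fun h _ => hC h, fun τ b hb0 hb h hh => ?_⟩
  refine (h1 h τ b hb0 hb).trans (mul_le_mul_of_nonneg_right ?_ hb0)
  exact Finset.single_le_sum (fun h _ => hC h) hh

end Growth

section Growth

open Filter Topology

theorem tendsto_of_abs_sub_le {X : ℕ → ℝ} {c B : ℝ} (hc : 0 < c) (hB : 0 < B)
    (hX : ∀ n, 0 ≤ X n) (h : ∀ ε : ℝ, 0 < ε → ∀ᶠ n in atTop, |X n - c| ≤ ε * (1 + B * X n)) :
    Tendsto X atTop (𝓝 c) := by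
  rw [Metric.tendsto_atTop']
  intro δ hδ
  have hK : 0 < 1 + B * (2 * c + 2) := by positivity
  set ε := min (min (1 / (2 * B)) 1) (δ / (2 * (1 + B * (2 * c + 2)))) with hε
  have hε0 : 0 < ε := by positivity
  obtain ⟨N, hN⟩ := eventually_atTop.1 (h ε hε0)
  refine ⟨N, fun n hn => ?_⟩
  have h1 := hN n hn.le
  have h2 : ε ≤ 1 := (min_le_left _ _).trans (min_le_right _ _)
  have h3 : ε * B ≤ 1 / 2 := by
    have : ε ≤ 1 / (2 * B) := (min_le_left _ _).trans (min_le_left _ _)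
    calc ε * B ≤ 1 / (2 * B) * B := by gcongr
      _ = 1 / 2 := by field_simp
  have h4 : ε * (1 + B * (2 * c + 2)) ≤ δ / 2 := by
    calc _ ≤ δ / (2 * (1 + B * (2 * c + 2))) * (1 + B * (2 * c + 2)) := by
          gcongr; exact min_le_right _ _
      _ = δ / 2 := by field_simp
  have h5 : X n ≤ 2 * c + 2 := by
    have := (abs_le.1 h1).2
    nlinarith [mul_le_mul_of_nonneg_right h3 (hX n)]
  rw [Real.dist_eq]
  calc |X n - c| ≤ ε * (1 + B * X n) := h1
    _ ≤ ε * (1 + B * (2 * c + 2)) := by gcongr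
    _ ≤ δ / 2 := h4
    _ < δ := half_lt_self hδ

theorem HasStrictDerivI.tendsto_ratio {a : I ≃o I} {c : ℝ} {e : I} (ha : HasStrictDerivI a c e)
    {x y : ℕ → I} (hx : Tendsto x atTop (𝓝 e)) (hy : Tendsto y atTop (𝓝 e)) {ε : ℝ} (hε : 0 < ε) :
    ∀ᶠ n in atTop, |((a (x n) : ℝ) - a (y n)) - c * (x n - y n)| ≤ ε * |(x n : ℝ) - y n| := by
  obtain ⟨U, hU, h⟩ := ha ε hε
  filter_upwards [hx hU, hy hU] with n h1 h2
  exact h _ h1 _ h2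

variable {M : Type*} [AddCommGroup M] {R : M → I ≃o I} {α : M ≃+ M} {a : I ≃o I}

theorem pow_conj (ha : ∀ m x, a (R m x) = R (α m) (a x)) (n : ℕ) (m : M) (x : I) :
    (a ^ n) (R m x) = R (α^[n] m) ((a ^ n) x) := by
  induction n with
  | zero => rfl
  | succ n ih =>
    rw [pow_succ', Function.iterate_succ_apply']
    change a ((a ^ n) (R m x)) = R (α (α^[n] m)) (a ((a ^ n) x))
    rw [ih, ha]

theorem iterate_symm_iterate (α : M ≃+ M) (n : ℕ) (m : M) : α^[n] (α.symm^[n] m) = m :=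
  Function.RightInverse.iterate α.apply_symm_apply n m

theorem inv_conj (ha : ∀ m x, a (R m x) = R (α m) (a x)) (m : M) (x : I) :
    a⁻¹ (R m x) = R (α.symm m) (a⁻¹ x) := by
  change a.symm (R m x) = R (α.symm m) (a.symm x)
  rw [OrderIso.symm_apply_eq, ha, AddEquiv.apply_symm_apply, OrderIso.apply_symm_apply]

/-- The functional `τ ∘ α⁻ⁿ`. -/
def pullbackIter (α : M ≃+ M) (τ : M →+ ℝ) (n : ℕ) : M →+ ℝ :=
  AddMonoidHom.mk' (fun m => τ (α.symm^[n] m)) fun m m' => by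
    rw [iterate_map_add, map_add]

theorem IsSignCompat.pullbackIter (ha : ∀ m x, a (R m x) = R (α m) (a x)) {τ : M →+ ℝ} {y : I}
    (h : IsSignCompat R τ y) (n : ℕ) : IsSignCompat R (pullbackIter α τ n) ((a ^ n) y) := by
  intro m hm
  have h1 := (a ^ n).strictMono (h _ hm)
  rwa [pow_conj ha, iterate_symm_iterate] at h1

theorem pullbackIter_succ (α : M ≃+ M) (τ : M →+ ℝ) (n : ℕ) (m : M) :
    pullbackIter α τ (n + 1) m = pullbackIter α τ n (α.symm m) := rfl

theorem pullbackIter_ne_zero {τ : M →+ ℝ} (hτ : τ ≠ 0) (n : ℕ) : pullbackIter α τ n ≠ 0 := by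
  intro h
  apply hτ
  ext m
  have := DFunLike.congr_fun h (α^[n] m)
  change τ (α.symm^[n] (α^[n] m)) = 0 at this
  rw [Function.LeftInverse.iterate α.symm_apply_apply n m] at this
  exact this

theorem exists_max_functional {S : Finset M}
    (hS : ∀ m : M, ∃ N : ℕ, 0 < N ∧ N • m ∈ AddSubgroup.closure (S : Set M)) {τ : M →+ ℝ}
    (hτ : τ ≠ 0) : ∃ f : M, (f ∈ S ∨ -f ∈ S) ∧ 0 < τ f ∧ ∀ s ∈ S, |τ s| ≤ τ f := by
  obtain ⟨m, hm⟩ : ∃ m, τ m ≠ 0 := by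
    by_contra! h
    exact hτ (AddMonoidHom.ext h)
  obtain ⟨C, hC, hb⟩ := abs_le_of_finite_rank hS m
  have hne : ∃ s ∈ S, τ s ≠ 0 := by
    by_contra! h
    have := hb τ 0 le_rfl fun s hs => by simp [h s hs]
    rw [mul_zero] at this
    exact hm (abs_nonpos_iff.1 this)
  obtain ⟨s₀, hs₀, hτs₀⟩ := hne
  obtain ⟨s, hs, hmax⟩ := S.exists_max_image (fun s => |τ s|) ⟨s₀, hs₀⟩
  have hpos : 0 < |τ s| := (abs_pos.2 hτs₀).trans_le (hmax s₀ hs₀)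
  rcases le_total 0 (τ s) with h | h
  · rw [abs_of_nonneg h] at hpos hmax
    exact ⟨s, Or.inl hs, hpos, hmax⟩
  · rw [abs_of_nonpos h] at hpos hmax
    exact ⟨-s, Or.inr (by rwa [neg_neg]), by rwa [map_neg], by rwa [map_neg]⟩

/-- The displacements of a finite generating set along an orbit of the normalizing map `a`
converging to a fixed point, compared with the lengths of a sequence of iterated intervals and with
the iterates of a compatible functional. -/
theorem exists_displ_growth (hR : ∀ m n, R (m + n) = R m * R n)
    (ha : ∀ m x, a (R m x) = R (α m) (a x)) {S : Finset M}
    (hS : ∀ m : M, ∃ N : ℕ, 0 < N ∧ N • m ∈ AddSubgroup.closure (S : Set M)) {e : I}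
    (he : ∀ m, R m e = e) (h1 : ∀ m, HasStrictDerivI (R m) 1 e) {c : ℝ} (hc : 0 < c)
    (hac : HasStrictDerivI a c e) {τ : M →+ ℝ} (hτ : τ ≠ 0) {y p q : I}
    (hτy : IsSignCompat R τ y) (hpq : p < q)
    (hy : Tendsto (fun n : ℕ => (a ^ n) y) atTop (𝓝 e))
    (hp : Tendsto (fun n : ℕ => (a ^ n) p) atTop (𝓝 e))
    (hq : Tendsto (fun n : ℕ => (a ^ n) q) atTop (𝓝 e)) :
    ∃ f : ℕ → M, (∀ n, f n ∈ S ∨ -f n ∈ S) ∧ (∀ n, 0 < pullbackIter α τ n (f n)) ∧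
      (∀ n, ∀ s ∈ S, |pullbackIter α τ n s| ≤ pullbackIter α τ n (f n)) ∧
      ∀ r : ℝ, 1 < r → ∃ C : ℝ, ∀ n,
        displ R (f n) ((a ^ n) y) ≤
          C * r ^ n * ((((a ^ n) q : I) : ℝ) - (a ^ n) p) * pullbackIter α τ n (f n) ∧
        ((((a ^ n) q : I) : ℝ) - (a ^ n) p) * pullbackIter α τ n (f n) ≤
          C * r ^ n * displ R (f n) ((a ^ n) y) := by
  classical
  choose f hfS hfpos hfmax using fun n =>
    exists_max_functional hS (pullbackIter_ne_zero (α := α) hτ n)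
  refine ⟨f, hfS, hfpos, hfmax, ?_⟩
  set T : Finset M := S ∪ S.image (fun s => -s) with hT
  have hfT : ∀ n, f n ∈ T := fun n => by
    rcases hfS n with h | h
    · exact Finset.mem_union_left _ h
    · exact Finset.mem_union_right _ (Finset.mem_image.2 ⟨_, h, neg_neg _⟩)
  obtain ⟨C₁, hC₁, hb₁⟩ := abs_le_of_finite_rank_of_finite hS (T.image α)
  obtain ⟨C₂, hC₂, hb₂⟩ := abs_le_of_finite_rank_of_finite hS (T.image α.symm)
  set B := max C₁ C₂ + 1 with hB
  have hB1 : C₁ ≤ B := (le_max_left _ _).trans (by linarith)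
  have hB2 : C₂ ≤ B := (le_max_right _ _).trans (by linarith)
  have hB0 : 0 < B := by have := le_max_left C₁ C₂; linarith
  set s : ℕ → ℝ := fun n => pullbackIter α τ n (f n) with hs
  set V : ℕ → ℝ := fun n => displ R (f n) ((a ^ n) y) with hV
  set l : ℕ → ℝ := fun n => (((a ^ n) q : I) : ℝ) - (a ^ n) p with hl
  have hs0 : ∀ n, 0 < s n := hfpos
  have hV0 : ∀ n, 0 < V n := fun n => (hτy.pullbackIter ha n).displ_pos (hfpos n)
  have hl0 : ∀ n, 0 < l n := fun n => sub_pos.2 ((a ^ n).strictMono hpq)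
  have hsucc : ∀ n m, pullbackIter α τ (n + 1) (α m) = pullbackIter α τ n m := fun n m => by
    rw [pullbackIter_succ, AddEquiv.symm_apply_apply]
  have hs1 : ∀ n, s n ≤ B * s (n + 1) := fun n => by
    have := hb₁ (pullbackIter α τ (n + 1)) (s (n + 1)) (hs0 _).le (hfmax _) (α (f n))
      (Finset.mem_image_of_mem _ (hfT n))
    rw [hsucc] at this
    exact (le_abs_self _).trans (this.trans (mul_le_mul_of_nonneg_right hB1 (hs0 _).le))
  have hs2 : ∀ n, s (n + 1) ≤ B * s n := fun n => by
    have := hb₂ (pullbackIter α τ n) (s n) (hs0 _).le (hfmax _) (α.symm (f (n + 1)))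
      (Finset.mem_image_of_mem _ (hfT (n + 1)))
    rw [← pullbackIter_succ] at this
    exact (le_abs_self _).trans (this.trans (mul_le_mul_of_nonneg_right hB2 (hs0 _).le))
  have hasucc : ∀ n x, (a ^ (n + 1)) x = a ((a ^ n) x) := fun n x => by rw [pow_succ']; rfl
  have hy' := (tendsto_add_atTop_iff_nat 1).2 hy
  have hstep : ∀ ε : ℝ, 0 < ε → ∀ᶠ n in atTop,
      |V (n + 1) * s n / (s (n + 1) * V n) - c| ≤
        ε * (1 + B * (V (n + 1) * s n / (s (n + 1) * V n))) := by
    intro ε hε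
    have hK : ∀ᶠ z in 𝓝 e, ∀ g ∈ T, ∀ f' ∈ T, ∀ τ : M →+ ℝ, IsSignCompat R τ z → 0 < τ f' →
        |τ (α g)| ≤ B * τ f' →
        |displ R (α g) z - τ (α g) / τ f' * displ R f' z| ≤ ε * displ R f' z :=
      (Finset.eventually_all T).2 fun g _ => (Finset.eventually_all T).2 fun f' _ =>
        displ_ratio hR he h1 (α g) f' hB0.le hε
    have hA : ∀ᶠ n in atTop, ∀ g ∈ T,
        |((a (R g ((a ^ n) y)) : I) : ℝ) - a ((a ^ n) y) - c * (R g ((a ^ n) y) - (a ^ n) y)| ≤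
          ε * |((R g ((a ^ n) y) : I) : ℝ) - (a ^ n) y| :=
      (Finset.eventually_all T).2 fun g _ => by
        have hg : Tendsto (fun n : ℕ => R g ((a ^ n) y)) atTop (𝓝 e) := by
          have := ((R g).continuous.tendsto e).comp hy
          rwa [he] at this
        exact hac.tendsto_ratio hg hy hε
    filter_upwards [hy'.eventually hK, hA] with n hn1 hn2
    have h3 := hn1 (f n) (hfT n) (f (n + 1)) (hfT (n + 1)) _ (hτy.pullbackIter ha (n + 1))
      (hfpos (n + 1)) (by
        rw [hsucc, abs_of_pos (hfpos n)]; exact hs1 n)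
    rw [hsucc] at h3
    have h4 := hn2 (f n) (hfT n)
    rw [ha, ← hasucc] at h4
    change |displ R (α (f n)) ((a ^ (n + 1)) y) - c * V n| ≤ ε * |V n| at h4
    rw [abs_of_pos (hV0 n)] at h4
    change |displ R (α (f n)) ((a ^ (n + 1)) y) - s n / s (n + 1) * V (n + 1)| ≤
      ε * V (n + 1) at h3
    set D := displ R (α (f n)) ((a ^ (n + 1)) y)
    set X := V (n + 1) * s n / (s (n + 1) * V n) with hX
    have hX0 : 0 < X := div_pos (mul_pos (hV0 _) (hs0 _)) (mul_pos (hs0 _) (hV0 _))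
    have e1 : s n / s (n + 1) * V (n + 1) = X * V n := by
      rw [hX]; field_simp [(hs0 (n + 1)).ne', (hV0 n).ne']
    have e2 : V (n + 1) ≤ B * X * V n := by
      have : V (n + 1) = (s (n + 1) / s n) * (X * V n) := by
        rw [hX]; field_simp [(hs0 (n + 1)).ne', (hV0 n).ne', (hs0 n).ne']
      rw [this, mul_assoc B]
      refine mul_le_mul_of_nonneg_right ?_ (mul_pos hX0 (hV0 n)).le
      rw [div_le_iff₀ (hs0 n)]
      exact hs2 n
    rw [e1] at h3
    have h5 : |X - c| * V n ≤ ε * (1 + B * X) * V n := by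
      rw [← abs_of_pos (hV0 n), ← abs_mul, abs_of_pos (hV0 n)]
      calc |(X - c) * V n| = |(D - c * V n) - (D - X * V n)| := by congr 1; ring
        _ ≤ ε * V n + ε * V (n + 1) := (abs_sub _ _).trans (add_le_add h4 h3)
        _ ≤ ε * V n + ε * (B * X * V n) := by gcongr
        _ = ε * (1 + B * X) * V n := by ring
    exact le_of_mul_le_mul_right h5 (hV0 n)
  have hX := tendsto_of_abs_sub_le hc hB0
    (fun n => (div_pos (mul_pos (hV0 _) (hs0 _)) (mul_pos (hs0 _) (hV0 _))).le) hstep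
  have hL : Tendsto (fun n => l (n + 1) / l n) atTop (𝓝 c) := by
    refine tendsto_of_abs_sub_le hc one_pos (fun n => (div_pos (hl0 _) (hl0 _)).le) fun ε hε => ?_
    filter_upwards [hac.tendsto_ratio hq hp hε] with n hn
    rw [← hasucc, ← hasucc] at hn
    change |l (n + 1) - c * l n| ≤ ε * |l n| at hn
    rw [abs_of_pos (hl0 n)] at hn
    have h5 : |l (n + 1) / l n - c| * l n ≤ ε * l n := by
      rw [← abs_of_pos (hl0 n), ← abs_mul, abs_of_pos (hl0 n), sub_mul,
        div_mul_cancel₀ _ (hl0 n).ne']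
      exact hn
    refine (le_of_mul_le_mul_right h5 (hl0 n)).trans ?_
    have := (div_pos (hl0 (n + 1)) (hl0 n)).le
    nlinarith
  set Q : ℕ → ℝ := fun n => V n / (l n * s n) with hQ
  have hQ0 : ∀ n, 0 < Q n := fun n => div_pos (hV0 n) (mul_pos (hl0 n) (hs0 n))
  have hQ1 : Tendsto (fun n => Q (n + 1) / Q n) atTop (𝓝 1) := by
    have := hX.div hL hc.ne'
    rw [div_self hc.ne'] at this
    refine this.congr fun n => ?_
    simp only [hQ, Pi.div_apply]
    field_simp [(hs0 (n + 1)).ne', (hV0 n).ne', (hs0 n).ne', (hl0 n).ne', (hl0 (n + 1)).ne']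
  have hQ2 : Tendsto (fun n => (Q (n + 1))⁻¹ / (Q n)⁻¹) atTop (𝓝 1) := by
    have := hQ1.inv₀ one_ne_zero
    rw [inv_one] at this
    refine this.congr fun n => ?_
    rw [inv_div_inv, inv_div]
  intro r hr
  obtain ⟨C, hC⟩ := le_pow_of_tendsto_ratio hQ0 hQ1 hr
  obtain ⟨C', hC'⟩ := le_pow_of_tendsto_ratio (fun n => inv_pos.2 (hQ0 n)) hQ2 hr
  refine ⟨max C C', fun n => ⟨?_, ?_⟩⟩
  · have := (hC n).trans (mul_le_mul_of_nonneg_right (le_max_left C C')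
      (pow_pos (one_pos.trans hr) n).le)
    rw [div_le_iff₀ (mul_pos (hl0 n) (hs0 n)), ← mul_assoc] at this
    exact this
  · have := (hC' n).trans (mul_le_mul_of_nonneg_right (le_max_right C C')
      (pow_pos (one_pos.trans hr) n).le)
    rw [hQ, inv_div, div_le_iff₀ (hV0 n)] at this
    exact this

end Growth

section Dynamics

open Filter Topology

variable {M : Type*} [AddCommGroup M]

/-- A `C¹` action on `[0,1]` of the semidirect product `ℤ ⋉ M`, where `M` is abelian, of finite rank
generated up to torsion by `S`, and the automorphism `α` of `M` induced by `1 ∈ ℤ` is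
hyperbolic. -/
structure IsHyperbolicAction (R : M → I ≃o I) (α : M ≃+ M) (a : I ≃o I) (S : Finset M) : Prop where
  map_add : ∀ m n, R (m + n) = R m * R n
  conj : ∀ m x, a (R m x) = R (α m) (a x)
  finite_rank : ∀ m : M, ∃ N : ℕ, 0 < N ∧ N • m ∈ AddSubgroup.closure (S : Set M)
  eq_zero : ∀ τ : M →+ ℝ, IsSubexp α τ → τ = 0
  deriv : ∀ m e, ∃ c, HasStrictDerivI (R m) c e
  deriv_conj : ∀ e, ∃ c, HasStrictDerivI a c e
  deriv_conj_symm : ∀ e, ∃ c, HasStrictDerivI a.symm c e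

theorem map_zero_orderIso (f : I ≃o I) : f 0 = 0 := map_bot f

theorem map_one_orderIso (f : I ≃o I) : f 1 = 1 := map_top f

theorem tendsto_pow_one {a : I ≃o I} (h : ∀ x ∈ Set.Ioo (0 : I) 1, x < a x) {x : I}
    (hx : x ∈ Set.Ioo (0 : I) 1) : Tendsto (fun n : ℕ => (a ^ n) x) atTop (𝓝 1) := by
  have hmono : Monotone fun n : ℕ => (a ^ n) x := by
    refine monotone_nat_of_le_succ fun n => ?_
    rw [pow_succ']
    exact (h _ (pow_mem_Ioo (map_zero_orderIso a) (map_one_orderIso a) hx n)).le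
  refine tendsto_order.2 ⟨fun z hz => ?_, fun z hz => absurd hz (not_lt.2 le_top)⟩
  obtain ⟨N, hN⟩ := exists_lt_pow h hx
    (⟨hx.1.trans_le (le_max_right z x), max_lt hz hx.2⟩ : max z x ∈ Set.Ioo (0 : I) 1)
  filter_upwards [eventually_ge_atTop N] with n hn
  exact (le_max_left z x).trans_lt (hN.trans_le (hmono hn))

theorem tendsto_pow_zero {a : I ≃o I} (h : ∀ x ∈ Set.Ioo (0 : I) 1, a x < x) {x : I}
    (hx : x ∈ Set.Ioo (0 : I) 1) : Tendsto (fun n : ℕ => (a ^ n) x) atTop (𝓝 0) := by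
  have hmono : Antitone fun n : ℕ => (a ^ n) x := by
    refine antitone_nat_of_succ_le fun n => ?_
    rw [pow_succ']
    exact (h _ (pow_mem_Ioo (map_zero_orderIso a) (map_one_orderIso a) hx n)).le
  have h' : ∀ x ∈ Set.Ioo (0 : I) 1, x < a⁻¹ x := fun x hx =>
    (OrderIso.lt_symm_apply a).2 (h x hx)
  refine tendsto_order.2 ⟨fun z hz => absurd hz (not_lt.2 bot_le), fun z hz => ?_⟩
  obtain ⟨N, hN⟩ := exists_lt_pow h'
    (⟨lt_min hz hx.1, (min_le_right z x).trans_lt hx.2⟩ : min z x ∈ Set.Ioo (0 : I) 1) hx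
  rw [inv_pow] at hN
  filter_upwards [eventually_ge_atTop N] with n hn
  exact (hmono hn).trans_lt (((OrderIso.lt_symm_apply (a ^ N)).1 hN).trans_le (min_le_left z x))

theorem exists_tendsto_endpoints {a : I ≃o I} (h : ∀ x ∈ Set.Ioo (0 : I) 1, a x ≠ x) :
    ∃ e e' : I, ((e = 0 ∧ e' = 1) ∨ (e = 1 ∧ e' = 0)) ∧ ∀ x ∈ Set.Ioo (0 : I) 1,
      Tendsto (fun n : ℕ => (a ^ n) x) atTop (𝓝 e) ∧
      Tendsto (fun n : ℕ => (a⁻¹ ^ n) x) atTop (𝓝 e') := by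
  rcases lt_or_lt_of_no_fixed_point h with h | h
  · exact ⟨1, 0, Or.inr ⟨rfl, rfl⟩, fun x hx => ⟨tendsto_pow_one h hx,
      tendsto_pow_zero (fun y hy => (OrderIso.symm_apply_lt a).2 (h y hy)) hx⟩⟩
  · exact ⟨0, 1, Or.inl ⟨rfl, rfl⟩, fun x hx => ⟨tendsto_pow_zero h hx,
      tendsto_pow_one (fun y hy => (OrderIso.lt_symm_apply a).2 (h y hy)) hx⟩⟩

namespace IsHyperbolicAction

variable {R : M → I ≃o I} {α : M ≃+ M} {a : I ≃o I} {S : Finset M}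

theorem inv (h : IsHyperbolicAction R α a S) : IsHyperbolicAction R α.symm a⁻¹ S where
  map_add := h.map_add
  conj := inv_conj h.conj
  finite_rank := h.finite_rank
  eq_zero := fun τ hτ => h.eq_zero τ fun m r hr => by
    obtain ⟨C, hC⟩ := hτ m r hr
    exact ⟨C, fun n => ⟨(hC n).2, (hC n).1⟩⟩
  deriv := h.deriv
  deriv_conj := h.deriv_conj_symm
  deriv_conj_symm := h.deriv_conj

theorem deriv_one (h : IsHyperbolicAction R α a S) {e : I} (he : ∀ f : I ≃o I, f e = e) (m : M) :
    HasStrictDerivI (R m) 1 e :=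
  hasStrictDerivI_one h.map_add h.conj h.eq_zero (fun m => he (R m)) (he a)
    (fun m => h.deriv m e) (h.deriv_conj e) (h.deriv_conj_symm e) m

theorem displ_growth (h : IsHyperbolicAction R α a S) {e : I} (he : ∀ f : I ≃o I, f e = e)
    {τ : M →+ ℝ} (hτ : τ ≠ 0) {y p q : I}
    (hτy : IsSignCompat R τ y) (hpq : p < q)
    (hy : Tendsto (fun n : ℕ => (a ^ n) y) atTop (𝓝 e))
    (hp : Tendsto (fun n : ℕ => (a ^ n) p) atTop (𝓝 e))
    (hq : Tendsto (fun n : ℕ => (a ^ n) q) atTop (𝓝 e)) :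
    ∃ f : ℕ → M, (∀ n, f n ∈ S ∨ -f n ∈ S) ∧ (∀ n, 0 < pullbackIter α τ n (f n)) ∧
      (∀ n, ∀ s ∈ S, |pullbackIter α τ n s| ≤ pullbackIter α τ n (f n)) ∧
      ∀ r : ℝ, 1 < r → ∃ C : ℝ, ∀ n,
        displ R (f n) ((a ^ n) y) ≤
          C * r ^ n * ((((a ^ n) q : I) : ℝ) - (a ^ n) p) * pullbackIter α τ n (f n) ∧
        ((((a ^ n) q : I) : ℝ) - (a ^ n) p) * pullbackIter α τ n (f n) ≤
          C * r ^ n * displ R (f n) ((a ^ n) y) := by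
  obtain ⟨c, hc⟩ := h.deriv_conj e
  obtain ⟨d, hd⟩ := h.deriv_conj_symm e
  exact exists_displ_growth h.map_add h.conj h.finite_rank (fun m => he (R m)) (h.deriv_one he)
    (hc.pos hd (he a)) hc hτ hτy hpq hy hp hq

theorem pow_fixed (h : IsHyperbolicAction R α a S) {x : I} (hx : ∀ m, R m x = x) (n : ℕ) (m : M) :
    R m ((a ^ n) x) = (a ^ n) x := by
  have := pow_conj h.conj n (α.symm^[n] m) x
  rw [iterate_symm_iterate, hx] at this
  exact this.symm

/-- On a wandering interval the translation numbers have subexponential growth. -/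
theorem subexp_of_fixed (h : IsHyperbolicAction R α a S) {e : I} (he : ∀ f : I ≃o I, f e = e)
    {τ : M →+ ℝ} (hτ : τ ≠ 0) {y p q : I} (hτy : IsSignCompat R τ y) (hy : y ∈ Set.Ioo p q)
    (hqfix : ∀ m, R m q = q)
    (hp : Tendsto (fun n : ℕ => (a ^ n) p) atTop (𝓝 e))
    (hq : Tendsto (fun n : ℕ => (a ^ n) q) atTop (𝓝 e)) (m : M) {r : ℝ} (hr : 1 < r) :
    ∃ C : ℝ, ∀ n : ℕ, |τ (α.symm^[n] m)| ≤ C * r ^ n := by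
  have hy' : Tendsto (fun n : ℕ => (a ^ n) y) atTop (𝓝 e) :=
    tendsto_of_tendsto_of_tendsto_of_le_of_le hp hq (fun n => (a ^ n).monotone hy.1.le)
      fun n => (a ^ n).monotone hy.2.le
  obtain ⟨f, -, hfpos, hfmax, hgrow⟩ := h.displ_growth he hτ hτy (hy.1.trans hy.2) hy' hp hq
  obtain ⟨C, hC⟩ := hgrow r hr
  obtain ⟨D, hD, hb⟩ := abs_le_of_finite_rank h.finite_rank m
  refine ⟨D * C, fun n => ?_⟩
  have h1 := hb (pullbackIter α τ n) _ (hfpos n).le (hfmax n)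
  have hl : 0 < (((a ^ n) q : I) : ℝ) - (a ^ n) p :=
    sub_pos.2 ((a ^ n).strictMono (hy.1.trans hy.2))
  have hV := (hτy.pullbackIter h.conj n).displ_pos (hfpos n)
  have hVl : displ R (f n) ((a ^ n) y) ≤ (((a ^ n) q : I) : ℝ) - (a ^ n) p := by
    have h2 : ((R (f n) ((a ^ n) y) : I) : ℝ) ≤ (a ^ n) q := by
      have := (R (f n)).monotone ((a ^ n).monotone hy.2.le)
      rwa [h.pow_fixed hqfix] at this
    have h3 : (((a ^ n) p : I) : ℝ) ≤ (a ^ n) y := (a ^ n).monotone hy.1.le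
    unfold displ
    linarith
  have h2 := (hC n).2
  have hCr : 0 < C * r ^ n :=
    pos_of_mul_pos_left ((mul_pos hl (hfpos n)).trans_le h2) hV.le
  have h3 : pullbackIter α τ n (f n) ≤ C * r ^ n := by
    have h4 := h2.trans (mul_le_mul_of_nonneg_left hVl hCr.le)
    rw [mul_comm] at h4
    exact le_of_mul_le_mul_right h4 hl
  calc |τ (α.symm^[n] m)| ≤ D * pullbackIter α τ n (f n) := h1
    _ ≤ D * (C * r ^ n) := mul_le_mul_of_nonneg_left h3 hD
    _ = D * C * r ^ n := by ring

theorem no_fixed_point_of_fixed (h : IsHyperbolicAction R α a S)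
    (hno : ∀ x ∈ Set.Ioo (0 : I) 1, (∀ m, R m x = x) → a x ≠ x) {x₀ : I}
    (hx₀ : x₀ ∈ Set.Ioo (0 : I) 1) (hfix : ∀ m, R m x₀ = x₀) :
    ∀ x ∈ Set.Ioo (0 : I) 1, a x ≠ x := by
  intro y hy hay
  obtain ⟨z, hz, hzF, haz⟩ := common_fixed_point (F := {x | ∀ m ∈ (Set.univ : Set M), R m x = x})
    (fun Z hZ => fixedPoints_sSup_sInf hZ) (s := a) (fun z => by
      constructor
      · intro h1 m _
        have h2 := h1 (α m) (Set.mem_univ _)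
        rw [← h.conj] at h2
        exact a.injective h2
      · intro h1 m _
        exact h.pow_fixed (fun m => h1 m (Set.mem_univ m)) 1 m) hx₀ (fun m _ => hfix m) hy hay
  exact hno z hz (fun m => hzF m (Set.mem_univ m)) haz

/-- If the abelian normal subgroup has a fixed point in the open interval, then it acts
trivially. -/
theorem trivial_of_fixed (h : IsHyperbolicAction R α a S)
    (hno : ∀ x ∈ Set.Ioo (0 : I) 1, (∀ m, R m x = x) → a x ≠ x) {x₀ : I}
    (hx₀ : x₀ ∈ Set.Ioo (0 : I) 1) (hfix : ∀ m, R m x₀ = x₀) (m : M) (x : I) : R m x = x := by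
  by_contra hmx
  have hfree := h.no_fixed_point_of_fixed hno hx₀ hfix
  have hx : x ∈ Set.Ioo (0 : I) 1 := by
    refine ⟨lt_of_le_of_ne bot_le fun h0 => hmx ?_, lt_of_le_of_ne le_top fun h0 => hmx ?_⟩
    · rw [← h0]; exact map_zero_orderIso _
    · rw [h0]; exact map_one_orderIso _
  obtain ⟨e, e', hee, hlim⟩ := exists_tendsto_endpoints hfree
  set F := {x | ∀ m ∈ (Set.univ : Set M), R m x = x} with hF
  set p := sSup {z | z ∈ F ∧ z ≤ x} with hp
  set q := sInf {z | z ∈ F ∧ x ≤ z} with hq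
  have hpF : p ∈ F := (fixedPoints_sSup_sInf fun z hz => hz.1).1
  have hqF : q ∈ F := (fixedPoints_sSup_sInf fun z hz => hz.1).2
  have hxF : x ∉ F := fun hxF => hmx (hxF m (Set.mem_univ m))
  have hpx : p < x := lt_of_le_of_ne (sSup_le fun z hz => hz.2) fun h0 => hxF (h0 ▸ hpF)
  have hxq : x < q := lt_of_le_of_ne (le_sInf fun z hz => hz.2) fun h0 => hxF (h0 ▸ hqF)
  have hlow : ∃ z ∈ Set.Ioo (0 : I) 1, z ∈ F ∧ z < x := by
    rcases hee with ⟨rfl, rfl⟩ | ⟨rfl, rfl⟩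
    · obtain ⟨n, hn⟩ := ((hlim x₀ hx₀).1.eventually_lt_const hx.1).exists
      exact ⟨_, pow_mem_Ioo (map_zero_orderIso _) (map_one_orderIso _) hx₀ n,
        fun m _ => h.pow_fixed hfix n m, hn⟩
    · obtain ⟨n, hn⟩ := ((hlim x₀ hx₀).2.eventually_lt_const hx.1).exists
      exact ⟨_, pow_mem_Ioo (map_zero_orderIso _) (map_one_orderIso _) hx₀ n,
        fun m _ => h.inv.pow_fixed hfix n m, hn⟩
  have hhigh : ∃ z ∈ Set.Ioo (0 : I) 1, z ∈ F ∧ x < z := by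
    rcases hee with ⟨rfl, rfl⟩ | ⟨rfl, rfl⟩
    · obtain ⟨n, hn⟩ := ((hlim x₀ hx₀).2.eventually_const_lt hx.2).exists
      exact ⟨_, pow_mem_Ioo (map_zero_orderIso _) (map_one_orderIso _) hx₀ n,
        fun m _ => h.inv.pow_fixed hfix n m, hn⟩
    · obtain ⟨n, hn⟩ := ((hlim x₀ hx₀).1.eventually_const_lt hx.2).exists
      exact ⟨_, pow_mem_Ioo (map_zero_orderIso _) (map_one_orderIso _) hx₀ n,
        fun m _ => h.pow_fixed hfix n m, hn⟩
  obtain ⟨z, hz, hzF, hzx⟩ := hlow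
  obtain ⟨w, hw, hwF, hxw⟩ := hhigh
  have hzp : z ≤ p := le_sSup (show z ∈ {z | z ∈ F ∧ z ≤ x} from ⟨hzF, hzx.le⟩)
  have hqw : q ≤ w := sInf_le (show w ∈ {z | z ∈ F ∧ x ≤ z} from ⟨hwF, hxw.le⟩)
  have hp01 : p ∈ Set.Ioo (0 : I) 1 := ⟨hz.1.trans_le hzp, hpx.trans hx.2⟩
  have hq01 : q ∈ Set.Ioo (0 : I) 1 := ⟨hx.1.trans hxq, hqw.trans_lt hw.2⟩
  obtain ⟨τ, hτ0, hτ⟩ := exists_translationNumber h.map_add h.finite_rank (hpx.trans hxq)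
    (fun m => hpF m (Set.mem_univ m)) (fun m => hqF m (Set.mem_univ m)) fun y hy => by
      by_contra! hyF
      rcases le_total y x with hyx | hyx
      · exact absurd (le_sSup (show y ∈ {z | z ∈ F ∧ z ≤ x} from ⟨fun m _ => hyF m, hyx⟩))
          (not_le.2 hy.1)
      · exact absurd (sInf_le (show y ∈ {z | z ∈ F ∧ x ≤ z} from ⟨fun m _ => hyF m, hyx⟩))
          (not_le.2 hy.2)
  have hcompat : IsSignCompat R τ x := fun m hm => hτ m hm x ⟨hpx, hxq⟩
  have he : ∀ f : I ≃o I, f e = e := fun f => by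
    rcases hee with ⟨rfl, -⟩ | ⟨rfl, -⟩
    · exact map_zero_orderIso f
    · exact map_one_orderIso f
  have he' : ∀ f : I ≃o I, f e' = e' := fun f => by
    rcases hee with ⟨-, rfl⟩ | ⟨-, rfl⟩
    · exact map_one_orderIso f
    · exact map_zero_orderIso f
  refine hτ0 (h.eq_zero τ fun m r hr => ?_)
  obtain ⟨C, hC⟩ := h.subexp_of_fixed he hτ0 hcompat ⟨hpx, hxq⟩
    (fun m => hqF m (Set.mem_univ m)) (hlim p hp01).1 (hlim q hq01).1 m hr
  obtain ⟨C', hC'⟩ := h.inv.subexp_of_fixed he' hτ0 hcompat ⟨hpx, hxq⟩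
    (fun m => hqF m (Set.mem_univ m)) (hlim p hp01).2 (hlim q hq01).2 m hr
  have hr0 : ∀ n : ℕ, 0 ≤ r ^ n := fun n => (pow_pos (one_pos.trans hr) n).le
  exact ⟨max C C', fun n =>
    ⟨(hC' n).trans (mul_le_mul_of_nonneg_right (le_max_right _ _) (hr0 n)),
      (hC n).trans (mul_le_mul_of_nonneg_right (le_max_left _ _) (hr0 n))⟩⟩

end IsHyperbolicAction

end Dynamics

section Affine

open Filter Topology

variable {M : Type*} [AddCommGroup M]

theorem map_zsmul_real (τ : M →+ ℝ) (k : ℤ) (m : M) : τ (k • m) = k * τ m := by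
  rw [map_zsmul, zsmul_eq_mul]

theorem map_nsmul_real (τ : M →+ ℝ) (k : ℕ) (m : M) : τ (k • m) = k * τ m := by
  rw [map_nsmul, nsmul_eq_mul]

theorem exists_pos_of_ne_zero {τ : M →+ ℝ} (hτ : τ ≠ 0) : ∃ f, 0 < τ f := by
  by_contra! h
  refine hτ (AddMonoidHom.ext fun m => le_antisymm (h m) ?_)
  have := h (-m)
  rw [map_neg] at this
  change 0 ≤ τ m
  linarith

theorem exists_proportional {τ τ' : M →+ ℝ} (hτ : τ ≠ 0) (h : ∀ m, 0 < τ m → 0 ≤ τ' m) :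
    ∃ c : ℝ, 0 ≤ c ∧ ∀ m, τ' m = c * τ m := by
  obtain ⟨f, hf⟩ := exists_pos_of_ne_zero hτ
  have hle : ∀ m, τ' f / τ f * τ m ≤ τ' m := by
    intro m
    by_contra! hlt
    obtain ⟨N, hN⟩ := exists_nat_gt (τ' f / (τ' f / τ f * τ m - τ' m))
    rw [div_lt_iff₀ (sub_pos.2 hlt)] at hN
    set u := τ m / τ f with hu
    have hm : τ m = u * τ f := by rw [hu, div_mul_cancel₀ _ hf.ne']
    have hm' : τ' f / τ f * τ m = u * τ' f := by rw [hu]; ring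
    rw [hm'] at hN
    set k := ⌈(N : ℝ) * u⌉ - 1 with hk
    have hk1 : (k : ℝ) < N * u := by
      have := Int.ceil_lt_add_one ((N : ℝ) * u)
      rw [hk]; push_cast; linarith
    have hk2 : (N : ℝ) * u ≤ k + 1 := by
      have := Int.le_ceil ((N : ℝ) * u)
      rw [hk]; push_cast; linarith
    have h1 := h (N • m - k • f) (by
      rw [map_sub, map_zsmul_real, map_nsmul_real, hm]
      have := mul_lt_mul_of_pos_right hk1 hf
      linarith)
    rw [map_sub, map_zsmul_real, map_nsmul_real] at h1
    have h2 := mul_le_mul_of_nonneg_right hk2 (h f hf)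
    linarith
  refine ⟨τ' f / τ f, div_nonneg (h f hf) hf.le, fun m => le_antisymm ?_ (hle m)⟩
  have := hle (-m)
  rw [map_neg, map_neg] at this
  linarith

theorem denseRange_of_map_eq_mul {α : M ≃+ M} {τ : M →+ ℝ} (hτ : τ ≠ 0) {c : ℝ} (hc0 : 0 < c)
    (hc1 : c ≠ 1) (h : ∀ m, τ (α m) = c * τ m) : DenseRange τ := by
  rcases AddSubgroup.dense_or_cyclic τ.range with hd | ⟨b, hb⟩
  · exact hd
  · exfalso
    have hmem : ∀ m, ∃ k : ℤ, τ m = k * b := fun m => by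
      have : τ m ∈ AddSubgroup.closure {b} := hb ▸ ⟨m, rfl⟩
      obtain ⟨k, hk⟩ := AddSubgroup.mem_closure_singleton.1 this
      exact ⟨k, by rw [← hk, zsmul_eq_mul]⟩
    have hb0 : b ≠ 0 := by
      rintro rfl
      refine hτ (AddMonoidHom.ext fun m => ?_)
      obtain ⟨k, hk⟩ := hmem m
      rw [hk, mul_zero]; rfl
    obtain ⟨m, hm⟩ : b ∈ τ.range := hb ▸ AddSubgroup.subset_closure rfl
    have h' : τ (α.symm m) = c⁻¹ * τ m := by
      have := h (α.symm m)
      rw [AddEquiv.apply_symm_apply] at this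
      rw [this, inv_mul_cancel_left₀ hc0.ne']
    obtain ⟨k, hk⟩ := hmem (α m)
    obtain ⟨l, hl⟩ := hmem (α.symm m)
    rw [h, hm] at hk
    rw [h', hm] at hl
    have hk' : c = k := mul_right_cancel₀ hb0 hk
    have hl' : c⁻¹ = l := mul_right_cancel₀ hb0 hl
    have hk1 : (1 : ℝ) ≤ c := by
      rw [hk'] at hc0 ⊢
      exact_mod_cast hc0
    have hl1 : (1 : ℝ) ≤ c⁻¹ := by
      have := inv_pos.2 hc0
      rw [hl'] at this ⊢
      exact_mod_cast this
    exact hc1 (le_antisymm ((one_le_inv₀ hc0).1 hl1) hk1)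

/-- `τ` is the translation number functional of an action on the open interval. -/
def IsCompat (R : M → I ≃o I) (τ : M →+ ℝ) : Prop :=
  ∀ m, 0 < τ m → ∀ x ∈ Set.Ioo (0 : I) 1, x < R m x

theorem orderIso_mem_Ioo (f : I ≃o I) {x : I} (hx : x ∈ Set.Ioo (0 : I) 1) :
    f x ∈ Set.Ioo (0 : I) 1 :=
  mapsTo_Ioo (map_zero_orderIso f) (map_one_orderIso f) hx

variable {R : M → I ≃o I} {τ : M →+ ℝ}

theorem action_add_apply (hR : ∀ m n, R (m + n) = R m * R n) (m n : M) (x : I) :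
    R (m + n) x = R m (R n x) := by rw [hR]; rfl

theorem action_neg_lt (hR : ∀ m n, R (m + n) = R m * R n) (m : M) {x y : I} :
    R (-m) x < y ↔ x < R m y := by
  rw [action_neg hR]
  exact OrderIso.symm_apply_lt (R m)

theorem IsCompat.lt_of_lt (hR : ∀ m n, R (m + n) = R m * R n) (hτ : IsCompat R τ) {m n : M}
    (h : τ m < τ n) {x : I} (hx : x ∈ Set.Ioo (0 : I) 1) : R m x < R n x := by
  have := hτ (n - m) (by rw [map_sub]; linarith) (R m x) (orderIso_mem_Ioo _ hx)
  rwa [← action_add_apply hR, sub_add_cancel] at this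

theorem IsCompat.exists_lt_nsmul (hR : ∀ m n, R (m + n) = R m * R n) (hτ : IsCompat R τ) {f : M}
    (hf : 0 < τ f) {x z : I} (hx : x ∈ Set.Ioo (0 : I) 1) (hz : z ∈ Set.Ioo (0 : I) 1) :
    ∃ k : ℕ, z < R (k • f) x := by
  obtain ⟨k, hk⟩ := exists_lt_pow (hτ f hf) hx hz
  exact ⟨k, by rwa [action_nsmul hR]⟩

/-- The semiconjugacy of an action to the action by translations given by `τ`. -/
noncomputable def semiconjMap (R : M → I ≃o I) (τ : M →+ ℝ) (x₀ x : I) : ℝ :=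
  sSup {t | ∃ m, τ m = t ∧ R m x₀ ≤ x}

theorem IsCompat.isLUB_semiconjMap (hR : ∀ m n, R (m + n) = R m * R n) (hτ : IsCompat R τ)
    (hτ0 : τ ≠ 0) {x₀ x : I} (hx₀ : x₀ ∈ Set.Ioo (0 : I) 1) (hx : x ∈ Set.Ioo (0 : I) 1) :
    IsLUB {t | ∃ m, τ m = t ∧ R m x₀ ≤ x} (semiconjMap R τ x₀ x) := by
  obtain ⟨f, hf⟩ := exists_pos_of_ne_zero hτ0
  refine isLUB_csSup ?_ ?_
  · obtain ⟨k, hk⟩ := hτ.exists_lt_nsmul hR hf hx hx₀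
    exact ⟨_, -(k • f), rfl, ((action_neg_lt hR _).2 hk).le⟩
  · obtain ⟨k, hk⟩ := hτ.exists_lt_nsmul hR hf hx₀ hx
    refine ⟨τ (k • f), ?_⟩
    rintro _ ⟨m, rfl, hm⟩
    by_contra! hlt
    exact absurd (hm.trans_lt hk) (not_lt.2 (hτ.lt_of_lt hR hlt hx₀).le)

theorem IsCompat.semiconjMap_mono (hR : ∀ m n, R (m + n) = R m * R n) (hτ : IsCompat R τ)
    (hτ0 : τ ≠ 0) {x₀ x y : I} (hx₀ : x₀ ∈ Set.Ioo (0 : I) 1) (hx : x ∈ Set.Ioo (0 : I) 1)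
    (hy : y ∈ Set.Ioo (0 : I) 1) (hxy : x ≤ y) : semiconjMap R τ x₀ x ≤ semiconjMap R τ x₀ y := by
  refine (hτ.isLUB_semiconjMap hR hτ0 hx₀ hx).2 ?_
  rintro _ ⟨m, rfl, hm⟩
  exact (hτ.isLUB_semiconjMap hR hτ0 hx₀ hy).1 ⟨m, rfl, hm.trans hxy⟩

theorem IsCompat.semiconjMap_apply (hR : ∀ m n, R (m + n) = R m * R n) (hτ : IsCompat R τ)
    (hτ0 : τ ≠ 0) {x₀ x : I} (hx₀ : x₀ ∈ Set.Ioo (0 : I) 1) (hx : x ∈ Set.Ioo (0 : I) 1) (m : M) :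
    semiconjMap R τ x₀ (R m x) = semiconjMap R τ x₀ x + τ m := by
  have key : ∀ (m : M) (x : I), x ∈ Set.Ioo (0 : I) 1 →
      semiconjMap R τ x₀ x + τ m ≤ semiconjMap R τ x₀ (R m x) := by
    intro m x hx
    rw [← le_sub_iff_add_le]
    refine (hτ.isLUB_semiconjMap hR hτ0 hx₀ hx).2 ?_
    rintro _ ⟨n, rfl, hn⟩
    have := (hτ.isLUB_semiconjMap hR hτ0 hx₀ (orderIso_mem_Ioo (R m) hx)).1
      ⟨m + n, rfl, by rw [action_add_apply hR]; exact (R m).monotone hn⟩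
    rw [map_add] at this
    linarith
  refine le_antisymm ?_ (key m x hx)
  have := key (-m) (R m x) (orderIso_mem_Ioo _ hx)
  rw [← action_add_apply hR, neg_add_cancel, action_zero hR, map_neg] at this
  change _ ≤ semiconjMap R τ x₀ x at this
  linarith

variable {α : M ≃+ M} {a : I ≃o I} {S : Finset M}

theorem exists_dilation (h : IsHyperbolicAction R α a S) (hτ : IsCompat R τ) (hτ0 : τ ≠ 0) :
    ∃ c : ℝ, 0 < c ∧ c ≠ 1 ∧ ∀ m, τ (α m) = c * τ m := by
  obtain ⟨c, hc0, hc⟩ := exists_proportional (τ := τ) (τ' := τ.comp (α : M →+ M)) hτ0 (by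
    intro m hm
    by_contra! hneg
    have hneg : τ (α m) < 0 := hneg
    obtain ⟨x, hx⟩ := exists_between (zero_lt_one (α := I))
    have h1 := hτ.lt_of_lt h.map_add (m := α m) (n := 0) (by rwa [map_zero]) (orderIso_mem_Ioo a hx)
    rw [← h.conj, action_zero h.map_add] at h1
    exact absurd (hτ m hm x hx) (not_lt.2 (a.lt_iff_lt.1 h1).le))
  have hc : ∀ m, τ (α m) = c * τ m := hc
  refine ⟨c, lt_of_le_of_ne hc0 ?_, ?_, hc⟩
  · rintro rfl
    refine hτ0 (AddMonoidHom.ext fun m => ?_)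
    have := hc (α.symm m)
    rw [AddEquiv.apply_symm_apply, zero_mul] at this
    exact this
  · rintro rfl
    exact hτ0 (h.eq_zero τ (isSubexp_of_map_eq fun m => by rw [hc, one_mul]))

theorem map_iterate_eq {c : ℝ} (h : ∀ m, τ (α m) = c * τ m) (n : ℕ) (m : M) :
    τ (α^[n] m) = c ^ n * τ m := by
  induction n with
  | zero => simp
  | succ n ih => rw [Function.iterate_succ_apply', h, ih, pow_succ']; ring

/-- No interval has all its translates disjoint from itself. -/
theorem not_wandering (h : IsHyperbolicAction R α a S) (hτ : IsCompat R τ) (hτ0 : τ ≠ 0) {c : ℝ}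
    (hc1 : 1 < c) (hc : ∀ m, τ (α m) = c * τ m) {p q : I} (hp : p ∈ Set.Ioo (0 : I) 1)
    (hq : q ∈ Set.Ioo (0 : I) 1) (hpq : p < q) : ∃ m, 0 < τ m ∧ R m p ≤ q := by
  have hR := h.map_add
  by_contra! hw
  obtain ⟨f, hf⟩ := exists_pos_of_ne_zero hτ0
  obtain ⟨e, he, p, hp, q, hq, hpq, hw, hpe, hqe⟩ : ∃ e : I, (∀ g : I ≃o I, g e = e) ∧
      ∃ p ∈ Set.Ioo (0 : I) 1, ∃ q ∈ Set.Ioo (0 : I) 1, p < q ∧ (∀ m, 0 < τ m → q < R m p) ∧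
        Tendsto (fun n : ℕ => (a ^ n) p) atTop (𝓝 e) ∧
        Tendsto (fun n : ℕ => (a ^ n) q) atTop (𝓝 e) := by
    by_cases hfree : ∀ x ∈ Set.Ioo (0 : I) 1, a x ≠ x
    · obtain ⟨e, e', hee, hlim⟩ := exists_tendsto_endpoints hfree
      refine ⟨e, fun g => ?_, p, hp, q, hq, hpq, hw, (hlim p hp).1, (hlim q hq).1⟩
      rcases hee with ⟨rfl, -⟩ | ⟨rfl, -⟩
      · exact map_zero_orderIso g
      · exact map_one_orderIso g
    · push Not at hfree
      obtain ⟨b, hb, hab⟩ := hfree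
      have habn : ∀ n : ℕ, (a ^ n) b = b := fun n => by
        induction n with
        | zero => rfl
        | succ n ih => rw [pow_succ']; change a ((a ^ n) b) = b; rw [ih, hab]
      obtain ⟨k, hk⟩ := hτ.exists_lt_nsmul hR hf (orderIso_mem_Ioo (R (-f)) hb) hq
      have hk' := (action_neg_lt hR (k • f)).2 hk
      have hlim : Tendsto (fun n : ℕ => (a ^ n) (R (-f) b)) atTop (𝓝 0) := by
        refine tendsto_order.2 ⟨fun z hz => absurd hz (not_lt.2 bot_le), fun z hz => ?_⟩
        have hz' : min z b ∈ Set.Ioo (0 : I) 1 := ⟨lt_min hz hb.1, (min_le_right z b).trans_lt hb.2⟩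
        obtain ⟨K, hK⟩ := hτ.exists_lt_nsmul hR hf hz' hb
        have hpow := (tendsto_pow_atTop_atTop_of_one_lt hc1).eventually_gt_atTop (K : ℝ)
        filter_upwards [hpow] with n hn
        rw [pow_conj h.conj, habn, iterate_map_neg]
        refine (action_neg_lt hR _).2 (hK.trans (lt_of_lt_of_le ?_
          ((R (α^[n] f)).monotone (min_le_left z b))))
        refine hτ.lt_of_lt hR ?_ hz'
        rw [map_iterate_eq hc, map_nsmul_real]
        exact mul_lt_mul_of_pos_right hn hf
      have hlim' : ∀ x ≤ R (-f) b, Tendsto (fun n : ℕ => (a ^ n) x) atTop (𝓝 0) := fun x hx =>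
        tendsto_of_tendsto_of_tendsto_of_le_of_le tendsto_const_nhds hlim (fun n => bot_le)
          fun n => (a ^ n).monotone hx
      have hpq' := (R (-(k • f))).strictMono hpq
      refine ⟨0, map_zero_orderIso, R (-(k • f)) p, orderIso_mem_Ioo _ hp, R (-(k • f)) q,
        orderIso_mem_Ioo _ hq, hpq', fun m hm => ?_, hlim' _ (hpq'.trans hk').le, hlim' _ hk'.le⟩
      rw [action_comm hR]
      exact (R _).strictMono (hw m hm)
  have hcompat : IsSignCompat R τ p := fun m hm => hτ m hm p hp
  obtain ⟨g, hgS, hgpos, -, hgrow⟩ := h.displ_growth he hτ0 hcompat hpq hpe hpe hqe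
  obtain ⟨r, hr1, hrc⟩ := exists_between hc1
  obtain ⟨C, hC⟩ := hgrow r hr1
  have hr0 : 0 < r := one_pos.trans hr1
  set D := ∑ s ∈ S, |τ s| with hD
  have hgD : ∀ n, τ (g n) ≤ D := fun n => by
    have hle : ∀ s ∈ S, |τ s| ≤ D := fun s hs =>
      Finset.single_le_sum (f := fun s => |τ s|) (fun s _ => abs_nonneg _) hs
    rcases hgS n with h1 | h1
    · exact (le_abs_self _).trans (hle _ h1)
    · have := hle _ h1
      rw [map_neg, abs_neg] at this
      exact (le_abs_self _).trans this
  have hpull : ∀ n m, τ m = c ^ n * pullbackIter α τ n m := fun n m => by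
    change τ m = c ^ n * τ (α.symm^[n] m)
    rw [← map_iterate_eq hc, iterate_symm_iterate]
  have hcn : ∀ n : ℕ, 0 < c ^ n := fun n => pow_pos (one_pos.trans hc1) n
  have hbound : ∀ n : ℕ, c ^ n ≤ C * r ^ n * D ∧ 0 < C := by
    intro n
    have hl : 0 < (((a ^ n) q : I) : ℝ) - (a ^ n) p := sub_pos.2 ((a ^ n).strictMono hpq)
    have hV : (((a ^ n) q : I) : ℝ) - (a ^ n) p ≤ displ R (g n) ((a ^ n) p) := by
      have h1 := (a ^ n).strictMono (hw (α.symm^[n] (g n)) (hgpos n))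
      rw [pow_conj h.conj, iterate_symm_iterate] at h1
      have h2 : (((a ^ n) q : I) : ℝ) < R (g n) ((a ^ n) p) := h1
      unfold displ
      linarith
    have h1 := hV.trans (hC n).1
    set l := (((a ^ n) q : I) : ℝ) - (a ^ n) p
    have h2 : 1 * l ≤ C * r ^ n * pullbackIter α τ n (g n) * l := by
      rw [one_mul]; linarith
    have h3 := le_of_mul_le_mul_right h2 hl
    have hCr : 0 < C * r ^ n := pos_of_mul_pos_left (one_pos.trans_le h3) (hgpos n).le
    refine ⟨?_, pos_of_mul_pos_left hCr (pow_pos hr0 n).le⟩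
    calc c ^ n = c ^ n * 1 := (mul_one _).symm
      _ ≤ c ^ n * (C * r ^ n * pullbackIter α τ n (g n)) :=
        mul_le_mul_of_nonneg_left h3 (hcn n).le
      _ = C * r ^ n * τ (g n) := by rw [hpull n (g n)]; ring
      _ ≤ C * r ^ n * D := mul_le_mul_of_nonneg_left (hgD n) hCr.le
  obtain ⟨n, hn⟩ := pow_unbounded_of_one_lt (C * D) ((one_lt_div hr0).2 hrc)
  rw [div_pow, lt_div_iff₀ (pow_pos hr0 n)] at hn
  have := (hbound n).1
  linarith

theorem semiconjMap_strictMono (h : IsHyperbolicAction R α a S) (hτ : IsCompat R τ) (hτ0 : τ ≠ 0)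
    {x₀ x y : I} (hx₀ : x₀ ∈ Set.Ioo (0 : I) 1) (hx : x ∈ Set.Ioo (0 : I) 1)
    (hy : y ∈ Set.Ioo (0 : I) 1) (hxy : x < y) : semiconjMap R τ x₀ x < semiconjMap R τ x₀ y := by
  have hw : ∃ m, 0 < τ m ∧ R m x ≤ y := by
    obtain ⟨c, hc0, hc1, hc⟩ := exists_dilation h hτ hτ0
    rcases lt_or_gt_of_ne hc1 with hlt | hgt
    · refine not_wandering h.inv hτ hτ0 ((one_lt_inv₀ hc0).2 hlt) (fun m => ?_) hx hy hxy
      rw [eq_inv_mul_iff_mul_eq₀ hc0.ne', ← hc, AddEquiv.apply_symm_apply]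
    · exact not_wandering h hτ hτ0 hgt hc hx hy hxy
  obtain ⟨m, hm, hmxy⟩ := hw
  have h1 := hτ.semiconjMap_mono h.map_add hτ0 hx₀ (orderIso_mem_Ioo (R m) hx) hy hmxy
  rw [hτ.semiconjMap_apply h.map_add hτ0 hx₀ hx] at h1
  linarith

/-- The conclusion of the rigidity theorem, in terms of the inverse of the conjugacy. -/
def IsAffineConj (R : M → I ≃o I) (a : I ≃o I) : Prop :=
  ∃ θ : ℝ → I, StrictMono θ ∧ Set.range θ = Set.Ioo 0 1 ∧
    (∀ m, ∃ t : ℝ, ∀ x, R m (θ x) = θ (x + t)) ∧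
    ∃ c t : ℝ, 0 < c ∧ ∀ x, a (θ x) = θ (c * x + t)

omit [AddCommGroup M] in
theorem isAffineConj_of_trivial (htriv : ∀ m x, R m x = x)
    (hfree : ∀ x ∈ Set.Ioo (0 : I) 1, a x ≠ x) : IsAffineConj R a := by
  rcases lt_or_lt_of_no_fixed_point hfree with h1 | h1
  · obtain ⟨θ, hθ, hrange, hθa⟩ := exists_conj_translation zero_lt_one (map_zero_orderIso a)
      (map_one_orderIso a) h1
    exact ⟨θ, hθ, hrange, fun m => ⟨0, fun x => by rw [htriv, add_zero]⟩, 1, 1, one_pos,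
      fun x => by rw [one_mul, hθa]⟩
  · obtain ⟨θ, hθ, hrange, hθa⟩ := exists_conj_translation zero_lt_one (map_zero_orderIso a⁻¹)
      (map_one_orderIso a⁻¹) fun x hx => (OrderIso.lt_symm_apply a).2 (h1 x hx)
    refine ⟨θ, hθ, hrange, fun m => ⟨0, fun x => by rw [htriv, add_zero]⟩, 1, -1, one_pos,
      fun x => ?_⟩
    have := hθa (x - 1)
    rw [sub_add_cancel] at this
    rw [one_mul, ← sub_eq_add_neg, this]
    exact a.apply_symm_apply _

theorem isAffineConj_of_compat (h : IsHyperbolicAction R α a S) (hτ : IsCompat R τ) (hτ0 : τ ≠ 0) :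
    IsAffineConj R a := by
  have hR := h.map_add
  obtain ⟨c, hc0, hc1, hc⟩ := exists_dilation h hτ hτ0
  have hdense := denseRange_of_map_eq_mul hτ0 hc0 hc1 hc
  obtain ⟨f, hf⟩ := exists_pos_of_ne_zero hτ0
  obtain ⟨x₀, hx₀⟩ := exists_between (zero_lt_one (α := I))
  let φ : Set.Ioo (0 : I) 1 → ℝ := fun x => semiconjMap R τ x₀ x
  let R' : M → Set.Ioo (0 : I) 1 → Set.Ioo (0 : I) 1 := fun m x => ⟨R m x, orderIso_mem_Ioo _ x.2⟩
  have hφR : ∀ m x, φ (R' m x) = φ x + τ m := fun m x =>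
    hτ.semiconjMap_apply hR hτ0 hx₀ x.2 m
  have hφ : StrictMono φ := fun x y hxy => semiconjMap_strictMono h hτ hτ0 hx₀ x.2 y.2 hxy
  let X₀ : Set.Ioo (0 : I) 1 := ⟨x₀, hx₀⟩
  have hφd : DenseRange φ := by
    have h1 : DenseRange fun m => φ X₀ + τ m :=
      (Homeomorph.addLeft (φ X₀)).surjective.denseRange.comp hdense
        (Homeomorph.addLeft (φ X₀)).continuous
    refine h1.mono ?_
    rintro _ ⟨m, rfl⟩
    exact ⟨R' m X₀, hφR m X₀⟩
  have hφc : Continuous φ := hφ.monotone.continuous_of_denseRange hφd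
  have : PreconnectedSpace (Set.Ioo (0 : I) 1) :=
    Subtype.preconnectedSpace isPreconnected_Ioo
  have hφs : Function.Surjective φ := by
    intro t
    obtain ⟨k, hk⟩ := exists_nat_ge ((t - φ X₀) / τ f)
    obtain ⟨l, hl⟩ := exists_nat_ge ((φ X₀ - t) / τ f)
    rw [div_le_iff₀ hf] at hk hl
    refine mem_range_of_exists_le_of_exists_ge hφc ⟨R' (-(l • f)) X₀, ?_⟩ ⟨R' (k • f) X₀, ?_⟩
    · rw [hφR, map_neg, map_nsmul_real]; linarith
    · rw [hφR, map_nsmul_real]; linarith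
  let Φ : Set.Ioo (0 : I) 1 ≃o ℝ := StrictMono.orderIsoOfSurjective φ hφ hφs
  have hΦ : ∀ x, Φ x = φ x := fun _ => rfl
  have hΦ' : ∀ t, φ (Φ.symm t) = t := fun t => Φ.apply_symm_apply t
  let A : Set.Ioo (0 : I) 1 → Set.Ioo (0 : I) 1 := fun x => ⟨a x, orderIso_mem_Ioo _ x.2⟩
  have hA : Continuous A := Continuous.subtype_mk (a.continuous.comp continuous_subtype_val) _
  have hAR : ∀ m x, A (R' m x) = R' (α m) (A x) := fun m x => Subtype.ext (h.conj m x)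
  have hRΦ : ∀ m t, R' m (Φ.symm t) = Φ.symm (t + τ m) := fun m t => by
    rw [OrderIso.eq_symm_apply, hΦ, hφR, hΦ']
  let F : ℝ → ℝ := fun t => φ (A (Φ.symm t))
  have hF : Continuous F := hφc.comp (hA.comp Φ.symm.continuous)
  have hFτ : ∀ m, F (τ m) = c * τ m + F 0 := fun m => by
    change φ (A (Φ.symm (τ m))) = _
    rw [← zero_add (τ m), ← hRΦ, hAR, hφR, hc, zero_add, add_comm]
  have hFaff : F = fun t => c * t + F 0 :=
    hdense.equalizer hF (by fun_prop) (funext hFτ)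
  refine ⟨fun t => Φ.symm t, fun s t hst => Φ.symm.strictMono hst, ?_, fun m => ⟨τ m, fun x => ?_⟩,
    c, F 0, hc0, fun x => ?_⟩
  · ext x
    constructor
    · rintro ⟨t, rfl⟩
      exact (Φ.symm t).2
    · intro hx
      exact ⟨Φ ⟨x, hx⟩, congrArg Subtype.val (Φ.symm_apply_apply ⟨x, hx⟩)⟩
  · exact congrArg Subtype.val (hRΦ m x)
  · have h1 : A (Φ.symm x) = Φ.symm (c * x + F 0) := by
      rw [OrderIso.eq_symm_apply]
      exact congrFun hFaff x
    exact congrArg Subtype.val h1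

theorem IsHyperbolicAction.isAffineConj (h : IsHyperbolicAction R α a S)
    (hno : ∀ x ∈ Set.Ioo (0 : I) 1, (∀ m, R m x = x) → a x ≠ x) : IsAffineConj R a := by
  by_cases hfix : ∃ x₀ ∈ Set.Ioo (0 : I) 1, ∀ m, R m x₀ = x₀
  · obtain ⟨x₀, hx₀, hfix⟩ := hfix
    exact isAffineConj_of_trivial (h.trivial_of_fixed hno hx₀ hfix)
      (h.no_fixed_point_of_fixed hno hx₀ hfix)
  · push Not at hfix
    obtain ⟨τ, hτ0, hτ⟩ := exists_translationNumber h.map_add h.finite_rank zero_lt_one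
      (fun m => map_zero_orderIso (R m)) (fun m => map_one_orderIso (R m)) hfix
    exact isAffineConj_of_compat h hτ hτ0

end Affine

section Assembly

/-- An orientation-preserving diffeomorphism as an automorphism of the ordered set `[0,1]`. -/
def diffToOrderIso : Diff1Plus →* (I ≃o I) where
  toFun f := { toEquiv := (f : I ≃ₜ I).toEquiv, map_rel_iff' := f.2.1.le_iff_le }
  map_one' := rfl
  map_mul' _ _ := rfl

theorem exists_hasStrictDerivI_diff (f : Diff1Plus) (e : I) :
    ∃ c, HasStrictDerivI (diffToOrderIso f) c e :=
  f.2.2.1.exists_hasStrictDerivI e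

theorem exists_finset_rank {d : ℕ} {H : AddSubgroup (Fin d → ℚ)}
    (hH : ∀ v : Fin d → ℚ, ∃ N : ℕ, 0 < N ∧ N • v ∈ H) :
    ∃ S : Finset H, ∀ m : H, ∃ N : ℕ, 0 < N ∧ N • m ∈ AddSubgroup.closure (S : Set H) := by
  classical
  choose N hN hNH using fun i : Fin d => hH (Pi.single i 1)
  refine ⟨Finset.univ.image fun i => ⟨_, hNH i⟩, fun m => ?_⟩
  set K := AddSubgroup.closure ((Finset.univ.image fun i => ⟨_, hNH i⟩ : Finset H) : Set H)
  have hspan : Submodule.span ℚ ((K.map H.subtype : AddSubgroup (Fin d → ℚ)) : Set (Fin d → ℚ))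
      = ⊤ := by
    rw [eq_top_iff, ← (Pi.basisFun ℚ (Fin d)).span_eq, Submodule.span_le]
    rintro _ ⟨i, rfl⟩
    have h1 : N i • (Pi.single i 1 : Fin d → ℚ) ∈ K.map H.subtype :=
      ⟨⟨_, hNH i⟩, AddSubgroup.subset_closure (Finset.mem_coe.2
        (Finset.mem_image_of_mem _ (Finset.mem_univ i))), rfl⟩
    have h2 := Submodule.smul_mem _ (N i : ℚ)⁻¹ (Submodule.subset_span (R := ℚ) h1)
    rw [← Nat.cast_smul_eq_nsmul ℚ, inv_smul_smul₀ (by exact_mod_cast (hN i).ne')] at h2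
    rwa [Pi.basisFun_apply]
  obtain ⟨k, hk, y, hy, hyk⟩ := exists_nsmul_mem_of_span_eq_top hspan (m : Fin d → ℚ)
  refine ⟨k, hk, ?_⟩
  have : y = k • m := Subtype.ext hyk
  exact this ▸ hy

/-- The linear automorphism `v ↦ A v`. -/
def mulVecEquiv {d : ℕ} (A : GL (Fin d) ℚ) : (Fin d → ℚ) ≃ₗ[ℚ] (Fin d → ℚ) where
  toFun v := (A : Matrix (Fin d) (Fin d) ℚ).mulVec v
  invFun v := ((A⁻¹ : GL (Fin d) ℚ) : Matrix (Fin d) (Fin d) ℚ).mulVec v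
  left_inv := (matAut A).left_inv
  right_inv := (matAut A).right_inv
  map_add' := Matrix.mulVec_add _
  map_smul' c v := Matrix.mulVec_smul _ c v

theorem inr_mul_inl_left {d : ℕ} (A : GL (Fin d) ℚ) (v : Fin d → ℚ) :
    (SemidirectProduct.inr (Multiplicative.ofAdd 1) *
      SemidirectProduct.inl (Multiplicative.ofAdd v) : MatSemidirect A).left =
      Multiplicative.ofAdd (mulVecEquiv A v) := by
  simp [SemidirectProduct.mul_left, zpowersHom_apply]
  rfl

theorem inr_inv_mul_inl_left {d : ℕ} (A : GL (Fin d) ℚ) (v : Fin d → ℚ) :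
    ((SemidirectProduct.inr (Multiplicative.ofAdd 1))⁻¹ *
      SemidirectProduct.inl (Multiplicative.ofAdd v) : MatSemidirect A).left =
      Multiplicative.ofAdd ((mulVecEquiv A).symm v) := by
  rw [← map_inv]
  simp [SemidirectProduct.mul_left, zpowersHom_apply]
  rfl

theorem inr_mul_inl {d : ℕ} (A : GL (Fin d) ℚ) (v : Fin d → ℚ) :
    (SemidirectProduct.inr (Multiplicative.ofAdd 1) *
      SemidirectProduct.inl (Multiplicative.ofAdd v) : MatSemidirect A) =
      SemidirectProduct.inl (Multiplicative.ofAdd (mulVecEquiv A v)) *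
        SemidirectProduct.inr (Multiplicative.ofAdd 1) := by
  refine SemidirectProduct.ext ?_ ?_
  · rw [inr_mul_inl_left]; simp
  · simp

theorem exists_affPlus_apply {c t : ℝ} (hc : 0 < c) :
    ∃ f : AffPlus, ∀ x, (f : ℝ ≃ᵃ[ℝ] ℝ) x = c * x + t := by
  refine ⟨⟨(LinearEquiv.smulOfNeZero ℝ ℝ c hc.ne').toAffineEquiv.trans
    (AffineEquiv.constVAdd ℝ ℝ t), ?_⟩, fun x => ?_⟩
  · change 0 < c • (1 : ℝ)
    simpa using hc
  · change t +ᵥ c • x = _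
    rw [vadd_eq_add, smul_eq_mul, add_comm]

variable {G : Type*} [Group G]

/-- The elements of `G` that act on `(0,1)` as affine maps after the change of variable `θ`. -/
def affineSubgroup (ρ : G →* Diff1Plus) (θ : ℝ → I) : Subgroup G where
  carrier := {g | ∃ f : AffPlus, ∀ x, diffToOrderIso (ρ g) (θ x) = θ ((f : ℝ ≃ᵃ[ℝ] ℝ) x)}
  one_mem' := ⟨1, fun x => by rw [map_one, map_one]; rfl⟩
  mul_mem' := by
    rintro g g' ⟨f, hf⟩ ⟨f', hf'⟩
    refine ⟨f * f', fun x => ?_⟩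
    rw [map_mul, map_mul]
    change diffToOrderIso (ρ g) (diffToOrderIso (ρ g') (θ x)) = θ ((f : ℝ ≃ᵃ[ℝ] ℝ) ((f' : ℝ ≃ᵃ[ℝ] ℝ) x))
    rw [hf', hf]
  inv_mem' := by
    rintro g ⟨f, hf⟩
    refine ⟨f⁻¹, fun x => ?_⟩
    rw [map_inv, map_inv]
    change (diffToOrderIso (ρ g)).symm (θ x) = θ ((f : ℝ ≃ᵃ[ℝ] ℝ).symm x)
    rw [OrderIso.symm_apply_eq, hf, AffineEquiv.apply_symm_apply]

theorem exists_topConjugate {ρ : G →* Diff1Plus} {θ : ℝ → I} (hθ : StrictMono θ)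
    (hrange : Set.range θ = Set.Ioo 0 1) (h : ∀ g, g ∈ affineSubgroup ρ θ) :
    ∃ ψ : G →* AffPlus, TopConjugate ρ ψ := by
  choose ψ hψ using h
  have hψ : ∀ g x, diffToOrderIso (ρ g) (θ x) = θ ((ψ g : ℝ ≃ᵃ[ℝ] ℝ) x) := hψ
  have hmul : ∀ g g', ψ (g * g') = ψ g * ψ g' := fun g g' => by
    refine Subtype.ext (AffineEquiv.ext fun x => hθ.injective ?_)
    rw [← hψ, map_mul, map_mul]
    change diffToOrderIso (ρ g) (diffToOrderIso (ρ g') (θ x)) =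
      θ ((ψ g : ℝ ≃ᵃ[ℝ] ℝ) ((ψ g' : ℝ ≃ᵃ[ℝ] ℝ) x))
    rw [hψ, hψ]
  have hmem : ∀ x, (θ x : ℝ) ∈ Set.Ioo (0 : ℝ) 1 := fun x => by
    have : θ x ∈ Set.Ioo (0 : I) 1 := hrange ▸ Set.mem_range_self x
    exact this
  let Θ : ℝ ≃o Set.Ioo (0 : ℝ) 1 := StrictMono.orderIsoOfSurjective
    (fun x => (⟨θ x, hmem x⟩ : Set.Ioo (0 : ℝ) 1)) (fun x y hxy => hθ hxy) (by
      rintro ⟨y, hy⟩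
      have : (⟨y, Set.Ioo_subset_Icc_self hy⟩ : I) ∈ Set.range θ := hrange ▸ hy
      obtain ⟨x, hx⟩ := this
      exact ⟨x, Subtype.ext (congrArg (fun z : I => (z : ℝ)) hx)⟩)
  refine ⟨MonoidHom.mk' ψ hmul, Θ.symm.toHomeomorph, fun g x => ?_⟩
  change Θ.symm (onIoo (ρ g) x) = (ψ g : ℝ ≃ᵃ[ℝ] ℝ) (Θ.symm x)
  obtain ⟨y, rfl⟩ := Θ.surjective x
  rw [OrderIso.symm_apply_apply, OrderIso.symm_apply_eq]
  exact Subtype.ext (congrArg (fun z : I => (z : ℝ)) (hψ g y))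

end Assembly

end AffRigidity

open AffRigidity in
theorem mainTheorem1 {d : ℕ} (A : GL (Fin d) ℚ)
    (hA : ∀ z : ℂ, Module.End.HasEigenvalue
      (Matrix.toLin' ((A : Matrix (Fin d) (Fin d) ℚ).map (algebraMap ℚ ℂ))) z → ‖z‖ ≠ 1)
    (H : AddSubgroup (Fin d → ℚ))
    (hH : Module.finrank ℚ (Submodule.span ℚ (H : Set (Fin d → ℚ))) = d)
    (G : Subgroup (MatSemidirect A))
    (hG : ∀ g : MatSemidirect A, g ∈ G ↔ Multiplicative.toAdd g.left ∈ H)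
    (ρ : G →* Diff1Plus)
    (hρ : ∀ x : Set.Ioo (0 : ℝ) 1, ∃ g : G, onIoo (ρ g) x ≠ x) :
    ∃ ψ : G →* AffPlus, TopConjugate ρ ψ := by
  have hspan : Submodule.span ℚ (H : Set (Fin d → ℚ)) = ⊤ :=
    Submodule.eq_top_of_finrank_eq (by rw [hH, Module.finrank_fin_fun])
  have hN := exists_nsmul_mem_of_span_eq_top hspan
  let ι : H → G := fun v => ⟨SemidirectProduct.inl (Multiplicative.ofAdd (v : Fin d → ℚ)),
    (hG _).2 v.2⟩
  let t : G := ⟨SemidirectProduct.inr (Multiplicative.ofAdd 1), (hG _).2 H.zero_mem⟩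
  have hT : ∀ v : H, mulVecEquiv A v ∈ H := fun v => by
    have := (hG _).1 (t * ι v).2
    rwa [show ((t * ι v : G) : MatSemidirect A).left = _ from inr_mul_inl_left A v] at this
  have hT' : ∀ v : H, (mulVecEquiv A).symm v ∈ H := fun v => by
    have := (hG _).1 (t⁻¹ * ι v).2
    rwa [show ((t⁻¹ * ι v : G) : MatSemidirect A).left = _ from inr_inv_mul_inl_left A v] at this
  let α : H ≃+ H :=
    { toFun := fun v => ⟨mulVecEquiv A v, hT v⟩
      invFun := fun v => ⟨(mulVecEquiv A).symm v, hT' v⟩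
      left_inv := fun v => Subtype.ext ((mulVecEquiv A).symm_apply_apply v)
      right_inv := fun v => Subtype.ext ((mulVecEquiv A).apply_symm_apply v)
      map_add' := fun v w => Subtype.ext (map_add (mulVecEquiv A) (v : Fin d → ℚ) w) }
  have hι : ∀ v w, ι (v + w) = ι v * ι w := fun v w =>
    Subtype.ext (map_mul SemidirectProduct.inl (Multiplicative.ofAdd (v : Fin d → ℚ))
      (Multiplicative.ofAdd (w : Fin d → ℚ)))
  have htι : ∀ v, t * ι v = ι (α v) * t := fun v => Subtype.ext (inr_mul_inl A v)
  have hgen : ∀ K : Subgroup G, (∀ v, ι v ∈ K) → t ∈ K → ∀ g, g ∈ K := by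
    intro K hK ht g
    have hg : g = ι ⟨Multiplicative.toAdd g.1.left, (hG _).1 g.2⟩ *
        t ^ (Multiplicative.toAdd g.1.right) := by
      refine Subtype.ext ?_
      change g.1 = SemidirectProduct.inl g.1.left *
        ((t ^ (Multiplicative.toAdd g.1.right) : G) : MatSemidirect A)
      rw [SubgroupClass.coe_zpow]
      change g.1 = SemidirectProduct.inl g.1.left *
        (SemidirectProduct.inr (Multiplicative.ofAdd 1)) ^ (Multiplicative.toAdd g.1.right)
      rw [← map_zpow, ← ofAdd_zsmul, smul_eq_mul, mul_one, ofAdd_toAdd,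
        SemidirectProduct.inl_left_mul_inr_right]
    rw [hg]
    exact K.mul_mem (hK _) (K.zpow_mem ht _)
  obtain ⟨S, hS⟩ := exists_finset_rank hN
  have hyp : IsHyperbolicAction (fun v => diffToOrderIso (ρ (ι v))) α (diffToOrderIso (ρ t)) S :=
    { map_add := fun v w => by rw [hι, map_mul, map_mul]
      conj := fun v x => by
        have := congrArg (fun g => diffToOrderIso (ρ g) x) (htι v)
        simp only [map_mul] at this
        exact this
      finite_rank := hS
      eq_zero := fun τ hτ => eq_zero_of_isSubexp (mulVecEquiv A)
        (fun z Θ hΘ hz => hA z (hasEigenvalue_of_functional _ hΘ hz)) hN α (fun _ => rfl) hτ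
      deriv := fun v e => exists_hasStrictDerivI_diff _ e
      deriv_conj := fun e => exists_hasStrictDerivI_diff _ e
      deriv_conj_symm := fun e => by
        have := exists_hasStrictDerivI_diff (ρ t)⁻¹ e
        rwa [map_inv] at this }
  obtain ⟨θ, hθ, hrange, hR, c, s, hc, ha⟩ := hyp.isAffineConj fun x hx hfix hax => by
    obtain ⟨g, hg⟩ := hρ ⟨x, hx⟩
    let K : Subgroup G := (MulAction.stabilizer (I ≃o I) x).comap (diffToOrderIso.comp ρ)
    have : g ∈ K := hgen K (fun v => hfix v) hax g
    exact hg (Subtype.ext (congrArg (fun z : I => (z : ℝ)) (show diffToOrderIso (ρ g) x = x from this)))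
  refine exists_topConjugate hθ hrange (hgen _ (fun v => ?_) ?_)
  · obtain ⟨u, hu⟩ := hR v
    obtain ⟨f, hf⟩ := exists_affPlus_apply (c := 1) (t := u) one_pos
    exact ⟨f, fun x => by rw [hf, one_mul]; exact hu x⟩
  · obtain ⟨f, hf⟩ := exists_affPlus_apply (c := c) (t := s) hc
    exact ⟨f, fun x => by rw [hf]; exact ha x⟩
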